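/- Let $p$ be a prime, $\mathbb{F}$ a finite field of characteristic $p$, $q=|\mathbb{F}|$, and let $\mathbf{W}(\mathbb{F})\to V$ be a totally ramified (finite flat) extension of discrete valuation rings; let $\pi$ be a uniformizer of $V$ (so $V/\pi V=\mathbb{F}$). Put $R=V[[x_2,\ldots,x_d]]$ and $R_\infty=\bigcup_{m>0}V[[x_2^{1/p^m},\ldots,x_d^{1/p^m}]]$. Let $R\to S$ be a module-finite extension (i.e. an injective module-finite ring map) of complete local domains, and let $a\in R$ be such that $R[\frac1a]\to S[\frac1a]$ is étale and the ideal $(\pi,a)$ of $R$ has height $2$. Let $S^+$ be the absolute integral closure of $S$, i.e. the integral closure of $S$ in an algebraic closure of its field of fractions. Then there is an embedding $R_\infty\hookrightarrow S^+$ extending $R\to S\subset S^+$, and for every such embedding there is an $S$-subalgebra $T$ of $S^+$ containing the image of $R_\infty$ with the following properties. (a) $T$ is a normal domain, $\pi$ is a non-zero non-unit of $T$, $T/\pi T$ is a reduced $\mathbb{F}_p$-algebra, and for every prime ideal $P$ of $T$ that is minimal over $\pi T$ the Frobenius endomorphism of $T/P$ is bijective. (b) The natural map $(R_\infty/\pi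 R_\infty)[\frac1a]\to (T/\pi T)[\frac1a]$ makes the target a filtered colimit of finite étale $(R_\infty/\pi R_\infty)[\frac1a]$-algebras, and the Frobenius endomorphism of $(T/\pi T)[\frac1a]$ is bijective. (c) For every prime ideal $P$ of $T$ that is minimal over $\pi T$ there is a ring automorphism $\mathbf{F}:T\to T$ such that $\mathbf{F}(P)=P$ and the induced map $T/P\to T/P$ is the $q$-th power map. -/

import Mathlib

open CategoryTheory

universe u v w

/-- A finite flat extension `W(F) → V` of discrete valuation rings is totally ramified:
`p W(F)` (the maximal ideal of `W(F)`) generates the `f`-th power of the maximal ideal of `V`,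
where `f` is the rank of `V` over `W(F)`. -/
def IsTotallyRamifiedOverWitt (p : ℕ) [Fact p.Prime] (F : Type w) [Field F] [CharP F p]
    (V : Type u) [CommRing V] [IsDomain V] [IsDiscreteValuationRing V]
    [Algebra (WittVector p F) V] : Prop :=
  Module.Finite (WittVector p F) V ∧ Module.Flat (WittVector p F) V ∧
    (Ideal.span {(p : WittVector p F)}).map (algebraMap (WittVector p F) V) =
      IsLocalRing.maximalIdeal V ^ Module.finrank (WittVector p F) V

/-- The absolute integral closure `A⁺` of a domain `A`: the integral closure of `A` in an
algebraic closure of its field of fractions. -/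
abbrev AbsoluteIntegralClosure (A : Type v) [CommRing A] [IsDomain A] : Type v :=
  integralClosure A (AlgebraicClosure (FractionRing A))

/-- The inclusion `V[[x^{1/p^m}]] → V[[x^{1/p^k}]]` for `m ≤ k`. Here `V[[x^{1/p^m}]]` is the power
series ring whose `i`-th variable is named `x_i^{1/p^m}`, so that the inclusion sends the `i`-th
variable to the `p^(k-m)`-th power of the `i`-th variable. -/
noncomputable def rootInclusion (p : ℕ) [hp : Fact p.Prime] (n : ℕ) (V : Type u) [CommRing V]
    (m k : ℕ) (_ : m ≤ k) : MvPowerSeries (Fin n) V →+* MvPowerSeries (Fin n) V :=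
  (MvPowerSeries.expand (p ^ (k - m)) (pow_ne_zero _ hp.out.ne_zero)).toRingHom

/-- `R_∞`, the union over `m` of the rings `V[[x_i^{1/p^m}]]`. -/
abbrev RInfty (p : ℕ) [Fact p.Prime] (n : ℕ) (V : Type u) [CommRing V] : Type u :=
  Ring.DirectLimit (fun _ : ℕ => MvPowerSeries (Fin n) V)
    (fun m k h => ⇑(rootInclusion p n V m k h))

/-- The inclusion of `R = V[[x]]`, the stage `m = 0`, into `R_∞`. -/
noncomputable def RInfty.ofBase (p : ℕ) [Fact p.Prime] (n : ℕ) (V : Type u) [CommRing V] :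
    MvPowerSeries (Fin n) V →+* RInfty p n V :=
  Ring.DirectLimit.of (fun _ : ℕ => MvPowerSeries (Fin n) V)
    (fun m k h => ⇑(rootInclusion p n V m k h)) 0

/-- `i` is an embedding of `R_∞` into `S⁺` that extends `R → S ⊆ S⁺`. -/
def IsEmbeddingOver (p : ℕ) [Fact p.Prime] (n : ℕ) {V : Type u} [CommRing V]
    {S : Type v} [CommRing S] [IsDomain S] [Algebra (MvPowerSeries (Fin n) V) S]
    (i : RInfty p n V →+* AbsoluteIntegralClosure S) : Prop :=
  Function.Injective i ∧
    i.comp (RInfty.ofBase p n V) =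
      (algebraMap S (AbsoluteIntegralClosure S)).comp (algebraMap (MvPowerSeries (Fin n) V) S)

/-- `A/ϖA[1/a]`. -/
abbrev ModAway (A : Type u) [CommRing A] (ϖ a : A) : Type u :=
  Localization.Away (Ideal.Quotient.mk (Ideal.span {ϖ}) a)

/-- The map `A/ϖA[1/a] → B/ϖB[1/a]` induced by a ring map `A → B`. -/
noncomputable def ModAway.map {A : Type u} {B : Type v} [CommRing A] [CommRing B] (j : A →+* B)
    (ϖ a : A) : ModAway A ϖ a →+* ModAway B (j ϖ) (j a) :=
  IsLocalization.Away.lift (Ideal.Quotient.mk (Ideal.span {ϖ}) a)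
    (g := (algebraMap (B ⧸ Ideal.span {j ϖ}) (ModAway B (j ϖ) (j a))).comp
      (Ideal.quotientMap (Ideal.span {j ϖ}) j (by
        rw [Ideal.span_singleton_le_iff_mem]
        exact Ideal.subset_span rfl)))
    (by
      rw [RingHom.comp_apply, Ideal.quotientMap_mk]
      exact IsLocalization.Away.algebraMap_isUnit _)

/-- A ring map `A → B` makes `B` a filtered colimit of finite étale `A`-algebras. -/
def IsIndFiniteEtale {A : Type u} {B : Type v} [CommRing A] [CommRing B] (f : A →+* B) : Prop :=
  letI := f.toAlgebra
  (CommAlgCat.finiteEtale.{v} A).ind.{v} (CommAlgCat.of A B)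

/-! Write A for R_∞, K for its fraction field and Ω for the algebraic closure of Frac S, which is
also an algebraic closure of K. The proof uses four facts about A: it is normal; π is prime in A and
does not divide a, which is all that the height condition is needed for; Frobenius is surjective on
A/π; and raising the variables to their q-th powers is an automorphism φ of A that fixes π and lifts
the q-th power map of A/π.

The ring T is the integral closure of A in a subfield L of Ω that is as large as étaleness over
(A/π)[1/a] permits. Étaleness is encoded by finitely many equations: a field N between K and Ω has a
Galois family if it contains elements x_i, y_i, integral over A, such that Σ x_i σ(y_i) is m for σ
in Gal(Ω/K) fixing N and 0 for all other σ, where m ∈ A becomes a unit in (A/π)[1/a]. These are the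
orthogonality relations of a Galois extension up to the factor m. They survive composita, because
families multiply, and transport along automorphisms of Ω that extend the identity of A, φ or φ⁻¹.
So the union L of these fields is a field, stable under Gal(Ω/K) and under every extension Φ₁ of φ.
It contains S, because the idempotent of the diagonal of S[1/a] over R[1/a], times a power of a, is
such a family (`algebraMap_mem_galoisFamilyUnion`).

Let N be finite Galois over K with a Galois family, and B its ring of integral elements. Everything
about B follows from the trace identity m b = Σ tr(b y_i) x_i (`GaloisCoordinates.sum_tr_smul`). It
makes (B/π)[1/a] projective, and m⁻¹ Σ x_i ⊗ y_i is a separability element, so this algebra is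
finite étale (`GaloisCoordinates.finite_and_etale`). The same relations for p-th powers show that
m^p b is a p-th power modulo π and that m kills the nilpotents of B/π. The factor m can be cancelled
because a is a nonzerodivisor on T/π, which follows from the normality of A
(`isIntegral_of_isIntegral_mul`).

For a prime P of T over π, the maps t ↦ Φ₁(t) mod P and t ↦ t^q mod P agree on A, the ring of Galois
invariants of T. By compactness of Gal(Ω/K) they differ by some σ in it
(`exists_forall_apply_smul_eq`), and Φ₁ ∘ σ is the required lift. Its surjectivity makes Frobenius
surjective on T/P. -/

/-! ### Normality of power series rings over noetherian normal domains. -/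

section PowerSeriesNormal
open PowerSeries nonZeroDivisors

variable {A : Type*} [CommRing A] [IsDomain A]

/-- Membership of the constant coefficient: if `X^j w` is almost integral over `A⟦X⟧`, then the
constant coefficient of `w` is integral over `A`. -/
lemma PowerSeries.isIntegral_constantCoeff_of_isAlmostIntegral [IsNoetherianRing A]
    {k : Type*} [Field k] [Algebra A k] [FaithfulSMul A k] (w : k⟦X⟧) (j : ℕ)
    (h : IsAlmostIntegral A⟦X⟧ ((X : k⟦X⟧) ^ j * w)) :
    IsIntegral A (constantCoeff w) := by
  obtain ⟨d, hd, hd'⟩ := h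
  have hd0 : d ≠ 0 := nonZeroDivisors.ne_zero hd
  obtain ⟨r, d', hr, hd1⟩ : ∃ (r : ℕ) (d' : A⟦X⟧), d = X ^ r * d' ∧ constantCoeff d' ≠ 0 := by
    refine ⟨d.order.toNat, divXPowOrder d, (X_pow_order_mul_divXPowOrder (f := d)).symm, ?_⟩
    rw [constantCoeff_divXPowOrder]
    exact coeff_order hd0
  -- The constant term of `d'` is a common denominator for all powers of the constant term of `w`.
  -- Over a noetherian ring this gives integrality.
  refine IsAlmostIntegral.isIntegral ⟨constantCoeff d', mem_nonZeroDivisors_of_ne_zero hd1,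
    fun n ↦ ?_⟩
  obtain ⟨g, hg⟩ := hd' n
  refine ⟨coeff (r + j * n) g, ?_⟩
  have e1 : (X : k⟦X⟧) ^ (r + j * n) * (PowerSeries.map (algebraMap A k) d' * w ^ n) =
      PowerSeries.map (algebraMap A k) g := by
    rw [show PowerSeries.map (algebraMap A k) g = algebraMap A⟦X⟧ k⟦X⟧ g from rfl, hg,
      Algebra.smul_def, hr]
    rw [show algebraMap A⟦X⟧ k⟦X⟧ (X ^ r * d') = PowerSeries.map (algebraMap A k) (X ^ r * d')
      from rfl]
    rw [map_mul, map_pow, PowerSeries.map_X]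
    ring
  rw [← coeff_map, ← e1]
  have := PowerSeries.coeff_X_pow_mul (PowerSeries.map (algebraMap A k) d' * w ^ n) (r + j * n) 0
  rw [zero_add] at this
  rw [this, coeff_zero_eq_constantCoeff_apply, map_mul, map_pow, Algebra.smul_def]
  rfl

/-- The coefficients are found to lie in A one after another: subtract the part already known,
divide by X^j, and the constant term of what is left is integral over A. -/
lemma PowerSeries.mem_range_map_of_isAlmostIntegral [IsNoetherianRing A] [IsIntegrallyClosed A]
    {k : Type*} [Field k] [Algebra A k] [IsFractionRing A k] (w : k⟦X⟧)
    (h : IsAlmostIntegral A⟦X⟧ w) : w ∈ (algebraMap A⟦X⟧ k⟦X⟧).range := by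
  have key : ∀ j, coeff j w ∈ (algebraMap A k).range := by
    intro j
    induction j using Nat.strong_induction_on with
    | _ j ih =>
      choose! c hc using ih
      let g : A⟦X⟧ := PowerSeries.mk fun i ↦ if i < j then c i else 0
      have h1 : IsAlmostIntegral A⟦X⟧ (w - algebraMap A⟦X⟧ k⟦X⟧ g) :=
        (completeIntegralClosure A⟦X⟧ k⟦X⟧).sub_mem h
          ((completeIntegralClosure A⟦X⟧ k⟦X⟧).algebraMap_mem g)
      have h2 : (X : k⟦X⟧) ^ j ∣ w - algebraMap A⟦X⟧ k⟦X⟧ g := by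
        rw [PowerSeries.X_pow_dvd_iff]
        intro m hm
        rw [map_sub, show algebraMap A⟦X⟧ k⟦X⟧ g = PowerSeries.map (algebraMap A k) g from rfl,
          coeff_map, coeff_mk, if_pos hm, hc m hm, sub_self]
      obtain ⟨w', hw'⟩ := h2
      rw [hw'] at h1
      have h3 := isIntegral_constantCoeff_of_isAlmostIntegral w' j h1
      obtain ⟨a, ha⟩ := IsIntegrallyClosed.algebraMap_eq_of_integral h3
      refine ⟨a, ?_⟩
      have h4 := congrArg (coeff j) hw'
      rw [map_sub, show algebraMap A⟦X⟧ k⟦X⟧ g = PowerSeries.map (algebraMap A k) g from rfl,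
          coeff_map, coeff_mk, if_neg (lt_irrefl j), map_zero, sub_zero] at h4
      have := PowerSeries.coeff_X_pow_mul w' j 0
      rw [zero_add] at this
      rw [h4, this, coeff_zero_eq_constantCoeff_apply, ha]
  choose c hc using key
  refine ⟨PowerSeries.mk c, ?_⟩
  ext j
  rw [show algebraMap A⟦X⟧ k⟦X⟧ (PowerSeries.mk c) = PowerSeries.map (algebraMap A k) _ from rfl,
    coeff_map, coeff_mk, hc]

/-- An integral element of the fraction field lies in k⟦X⟧, which is normal. Almost integrality
involves only the products d z^n, so it carries over to k⟦X⟧, where the coefficients can be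
examined. -/
instance PowerSeries.isIntegrallyClosed [IsNoetherianRing A] [IsIntegrallyClosed A] :
    IsIntegrallyClosed A⟦X⟧ := by
  let k := FractionRing A
  let L := FractionRing k⟦X⟧
  have inj : Function.Injective (algebraMap A⟦X⟧ k⟦X⟧) :=
    PowerSeries.map_injective _ (FaithfulSMul.algebraMap_injective A k)
  have : FaithfulSMul A⟦X⟧ k⟦X⟧ := (faithfulSMul_iff_algebraMap_injective _ _).mpr inj
  have injL : Function.Injective (algebraMap A⟦X⟧ L) := by
    rw [IsScalarTower.algebraMap_eq A⟦X⟧ k⟦X⟧ L]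
    exact (FaithfulSMul.algebraMap_injective k⟦X⟧ L).comp inj
  let ψ : FractionRing A⟦X⟧ →ₐ[A⟦X⟧] L := IsLocalization.liftAlgHom (M := A⟦X⟧⁰)
    (f := Algebra.ofId A⟦X⟧ L) (fun y ↦ by
      refine IsUnit.mk0 _ ?_
      have := nonZeroDivisors.ne_zero y.2
      exact (map_ne_zero_iff _ injL).mpr this)
  refine (isIntegrallyClosed_iff (FractionRing A⟦X⟧)).mpr fun {z} hz ↦ ?_
  have hz1 : IsIntegral k⟦X⟧ (ψ z) := (hz.map ψ).tower_top
  obtain ⟨w, hw⟩ := IsIntegrallyClosed.algebraMap_eq_of_integral hz1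
  obtain ⟨d, hd, hd'⟩ := hz.isAlmostIntegral
  have hw2 : IsAlmostIntegral A⟦X⟧ w := by
    refine ⟨d, hd, fun n ↦ ?_⟩
    obtain ⟨g, hg⟩ := hd' n
    refine ⟨g, FaithfulSMul.algebraMap_injective k⟦X⟧ L ?_⟩
    rw [← IsScalarTower.algebraMap_apply, Algebra.smul_def, map_mul, map_pow, hw,
      ← IsScalarTower.algebraMap_apply, ← ψ.commutes g, hg, Algebra.smul_def, map_mul, map_pow,
      ψ.commutes]
  obtain ⟨g, hg⟩ := mem_range_map_of_isAlmostIntegral w hw2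
  refine ⟨g, ψ.toRingHom.injective ?_⟩
  change ψ _ = ψ z
  rw [ψ.commutes, IsScalarTower.algebraMap_apply A⟦X⟧ k⟦X⟧ L, hg, hw]

lemma MvPowerSeries.isIntegrallyClosed_fin [IsNoetherianRing A] [IsIntegrallyClosed A] (n : ℕ) :
    IsIntegrallyClosed (MvPowerSeries (Fin n) A) := by
  induction n with
  | zero => exact .of_equiv (isEmptyEquiv (R := A) (Fin 0)).toRingEquiv.symm
  | succ n ih =>
    have : IsDomain (MvPowerSeries (Fin n) A) := NoZeroDivisors.to_isDomain _
    have := PowerSeries.isIntegrallyClosed (A := MvPowerSeries (Fin n) A)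
    exact .of_equiv (finSuccEquiv A n).toRingEquiv.symm

end PowerSeriesNormal

/-! ### The residue field and the characteristic of V. -/

section ResidueField

open IsLocalRing

variable {p : ℕ} [Fact p.Prime] {F : Type w} [Field F] [Finite F] [CharP F p]
  {V : Type u} [CommRing V] [IsDomain V] [IsDiscreteValuationRing V]
  [Algebra (WittVector p F) V]

lemma WittVector.maximalIdeal_eq_span_p (p : ℕ) [Fact p.Prime] (F : Type*) [Field F]
    [CharP F p] [PerfectRing F p] :
    maximalIdeal (WittVector p F) = Ideal.span {(p : WittVector p F)} :=
  (WittVector.irreducible p (k := F)).maximalIdeal_eq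

lemma WittVector.charZero_of_charP (p : ℕ) [Fact p.Prime] (F : Type*) [Field F] [CharP F p] :
    CharZero (WittVector p F) := by
  obtain ⟨l, hl⟩ := CharP.exists (WittVector p F)
  rcases CharP.char_is_prime_or_zero (WittVector p F) l with h | rfl
  · have h1 : (l : F) = 0 := by
      have := congrArg (WittVector.constantCoeff (p := p) (R := F))
        (CharP.cast_eq_zero (WittVector p F) l)
      rwa [map_natCast, map_zero] at this
    have h2 : p = l :=
      (Nat.prime_dvd_prime_iff_eq Fact.out h).mp ((CharP.cast_eq_zero_iff F p l).mp h1)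
    subst h2
    exact absurd (CharP.cast_eq_zero (WittVector p F) p) (WittVector.p_nonzero p F)
  · exact CharP.charP_to_charZero _

lemma IsTotallyRamifiedOverWitt.finrank_pos (hV : IsTotallyRamifiedOverWitt p F V) :
    0 < Module.finrank (WittVector p F) V := by
  obtain ⟨_, _, _⟩ := hV
  have : Module.Free (WittVector p F) V := Module.free_of_flat_of_isLocalRing
  exact Module.finrank_pos

/-- Count V/pV twice, with e the rank: as a vector space of dimension e over W(F)/p = F it has |F|^e
elements, and as V/𝔪^e it has |V/𝔪|^e elements. -/
lemma IsTotallyRamifiedOverWitt.natCard_quotient (hV : IsTotallyRamifiedOverWitt p F V) :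
    Nat.card (V ⧸ maximalIdeal V) = Nat.card F := by
  have hpos := hV.finrank_pos
  obtain ⟨_, _, hram⟩ := hV
  have : Module.Free (WittVector p F) V := Module.free_of_flat_of_isLocalRing
  rw [← WittVector.maximalIdeal_eq_span_p] at hram
  let e := Module.finrank (WittVector p F) V
  let : Field (WittVector p F ⧸ maximalIdeal (WittVector p F)) := Ideal.Quotient.field _
  have : Module.Finite (WittVector p F ⧸ maximalIdeal (WittVector p F))
    (V ⧸ (maximalIdeal (WittVector p F)).map (algebraMap (WittVector p F) V)) :=
      Module.Finite.of_restrictScalars_finite (WittVector p F) _ _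
  have h1 := Module.natCard_eq_pow_finrank
    (K := WittVector p F ⧸ maximalIdeal (WittVector p F))
    (V := V ⧸ (maximalIdeal (WittVector p F)).map (algebraMap (WittVector p F) V))
  rw [IsLocalRing.finrank_quotient_map] at h1
  have h2 : Nat.card (WittVector p F ⧸ maximalIdeal (WittVector p F)) = Nat.card F := by
    rw [WittVector.maximalIdeal_eq_span_p]
    exact Nat.card_congr (WittVector.quotientPEquiv (p := p) (k := F)).toEquiv
  rw [h2, hram] at h1
  have h3 := cardQuot_pow_of_prime (P := maximalIdeal V) (i := e)
    (IsDiscreteValuationRing.not_a_field V)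
  rw [Submodule.cardQuot_apply, Submodule.cardQuot_apply, h1] at h3
  exact (Nat.pow_left_injective (Nat.pos_iff_ne_zero.mp hpos) h3).symm

lemma IsTotallyRamifiedOverWitt.dvd_natCast (hV : IsTotallyRamifiedOverWitt p F V) {π : V}
    (hπ : Irreducible π) : π ∣ (p : V) := by
  have hpos := hV.finrank_pos
  obtain ⟨_, _, hram⟩ := hV
  rw [← Ideal.mem_span_singleton, ← hπ.maximalIdeal_eq]
  refine Ideal.pow_le_self hpos.ne' (hram.le (Ideal.mem_map_of_mem _
    (Ideal.mem_span_singleton_self (p : WittVector p F))) |> fun h ↦ ?_)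
  simpa using h

lemma IsTotallyRamifiedOverWitt.charZero (hV : IsTotallyRamifiedOverWitt p F V) :
    CharZero V := by
  obtain ⟨_, _, hram⟩ := hV
  have : Module.Free (WittVector p F) V := Module.free_of_flat_of_isLocalRing
  have hinj : Function.Injective (algebraMap (WittVector p F) V) :=
    FaithfulSMul.algebraMap_injective _ _
  have : CharZero (WittVector p F) := WittVector.charZero_of_charP p F
  exact charZero_of_injective_algebraMap hinj

lemma IsTotallyRamifiedOverWitt.dvd_pow_natCard_sub (hV : IsTotallyRamifiedOverWitt p F V) {π : V}
    (hπ : Irreducible π) (x : V) : π ∣ x ^ Nat.card F - x := by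
  have hc := hV.natCard_quotient
  let : Field (V ⧸ maximalIdeal V) := Ideal.Quotient.field _
  have : Finite (V ⧸ maximalIdeal V) := Nat.finite_of_card_ne_zero (by
    rw [hc]; exact Nat.card_pos.ne')
  let := Fintype.ofFinite (V ⧸ maximalIdeal V)
  rw [← Ideal.mem_span_singleton, ← hπ.maximalIdeal_eq, ← Ideal.Quotient.eq_zero_iff_mem,
    map_sub, map_pow, ← hc, Nat.card_eq_fintype_card, FiniteField.pow_card, sub_self]

end ResidueField

/-! ### Generalities on characteristic p and integral elements. -/

lemma CharP.of_prime_of_natCast_eq_zero {R : Type*} [CommRing R] [Nontrivial R] {p : ℕ}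
    (hp : p.Prime) (h : (p : R) = 0) : CharP R p := by
  obtain ⟨l, hl⟩ := CharP.exists R
  rcases (Nat.dvd_prime hp).mp ((CharP.cast_eq_zero_iff R l p).mp h) with rfl | rfl
  · exact absurd rfl (CharP.char_ne_one R 1)
  · exact hl

lemma charP_quotient_span_singleton {V : Type*} [CommRing V] {ϖ : V} (hϖ : ¬ IsUnit ϖ) {p : ℕ}
    (hp : p.Prime) (h : ϖ ∣ (p : V)) : CharP (V ⧸ Ideal.span {ϖ}) p := by
  have : Nontrivial (V ⧸ Ideal.span {ϖ}) :=
    Ideal.Quotient.nontrivial_iff.mpr fun h ↦ hϖ (Ideal.span_singleton_eq_top.mp h)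
  refine CharP.of_prime_of_natCast_eq_zero hp ?_
  rw [← map_natCast (Ideal.Quotient.mk (Ideal.span {ϖ})), Ideal.Quotient.eq_zero_iff_mem,
    Ideal.mem_span_singleton]
  exact h

lemma RingHom.isIntegralElem_sum_mul {R S ι : Type*} [CommRing R] [CommRing S] (f : R →+* S)
    (s : Finset ι) (e : ι → S) (c e' : ι → R) {q : ℕ} (hq : 0 < q) (he : ∀ i, e i ^ q = f (e' i)) :
    f.IsIntegralElem (∑ i ∈ s, e i * f (c i)) := by
  algebraize [f]
  exact IsIntegral.sum _ fun i _ ↦ IsIntegral.mul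
    (.of_pow hq (he i ▸ isIntegral_algebraMap (R := R) (x := e' i))) isIntegral_algebraMap

lemma RingHom.IsIntegralElem.comp_of_isIntegral {R S T : Type*} [CommRing R] [CommRing S]
    [CommRing T] {f : R →+* S} {g : S →+* T} (hf : ∀ s, f.IsIntegralElem s) {t : T}
    (ht : g.IsIntegralElem t) : (g.comp f).IsIntegralElem t := by
  algebraize [f, g, g.comp f]
  have : Algebra.IsIntegral R S := ⟨hf⟩
  exact isIntegral_trans (R := R) t ht

lemma algebraMap_algebraicClosure_injective (S : Type*) [CommRing S] [IsDomain S] :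
    Function.Injective (algebraMap S (AlgebraicClosure (FractionRing S))) := by
  rw [IsScalarTower.algebraMap_eq S (FractionRing S)]
  exact (algebraMap (FractionRing S) _).injective.comp (FaithfulSMul.algebraMap_injective S _)

/-! ### Power series modulo a constant, and the substitution x ↦ x^q. -/

namespace MvPowerSeries

variable {σ : Type*} {V : Type*} [CommRing V]

lemma expand_injective [Finite σ] {q : ℕ} (hq : q ≠ 0) :
    Function.Injective (expand (σ := σ) (R := V) q hq) := by
  intro f g h
  ext d
  rw [← coeff_expand_smul q hq, h, coeff_expand_smul]

lemma C_dvd_iff {c : V} {f : MvPowerSeries σ V} :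
    C c ∣ f ↔ ∀ d, c ∣ coeff d f := by
  constructor
  · rintro ⟨g, rfl⟩ d
    rw [coeff_C_mul]
    exact dvd_mul_right _ _
  · intro h
    choose g hg using h
    let G : MvPowerSeries σ V := fun d ↦ g d
    have hG : ∀ d, coeff d G = g d := fun _ ↦ rfl
    refine ⟨G, ?_⟩
    ext d
    rw [coeff_C_mul, hg d, hG]

lemma C_dvd_iff_map_eq_zero {c : V} {f : MvPowerSeries σ V} :
    C c ∣ f ↔ map (Ideal.Quotient.mk (Ideal.span {c})) f = 0 := by
  rw [C_dvd_iff, MvPowerSeries.ext_iff]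
  refine forall_congr' fun d ↦ ?_
  rw [coeff_map, coeff_zero, Ideal.Quotient.eq_zero_iff_mem, Ideal.mem_span_singleton]

lemma C_dvd_sub_iff {c : V} {f g : MvPowerSeries σ V} :
    C c ∣ f - g ↔ map (Ideal.Quotient.mk (Ideal.span {c})) f =
      map (Ideal.Quotient.mk (Ideal.span {c})) g := by
  rw [C_dvd_iff_map_eq_zero, map_sub, sub_eq_zero]

lemma C_dvd_expand_iff [Finite σ] {c : V} {q : ℕ} (hq : q ≠ 0) {f : MvPowerSeries σ V} :
    C c ∣ expand q hq f ↔ C c ∣ f := by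
  constructor
  · intro h
    rw [C_dvd_iff] at h ⊢
    intro d
    simpa using h (q • d)
  · rintro ⟨g, rfl⟩
    rw [map_mul, expand_C]
    exact dvd_mul_right _ _

lemma prime_C {c : V} (hc : Prime c) : Prime (C c : MvPowerSeries σ V) := by
  have : (Ideal.span {c}).IsPrime := (Ideal.span_singleton_prime hc.ne_zero).mpr hc
  refine ⟨?_, ?_, fun f g h ↦ ?_⟩
  · rw [Ne, map_eq_zero_iff C (C_injective)]
    exact hc.ne_zero
  · intro h
    have := h.map (constantCoeff (σ := σ) (R := V))
    rw [constantCoeff_C] at this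
    exact hc.not_isUnit this
  · simp only [C_dvd_iff_map_eq_zero] at h ⊢
    rwa [map_mul, mul_eq_zero] at h

/-- Every power series is integral over the power series in the `q`-th powers of the variables. -/
lemma expand_isIntegralElem (n q : ℕ) (hq : q ≠ 0) (f : MvPowerSeries (Fin n) V) :
    (expand (σ := Fin n) (R := V) q hq).toRingHom.IsIntegralElem f := by
  classical
  let e : (Fin n → Fin q) → (Fin n →₀ ℕ) := fun I ↦ Finsupp.equivFunOnFinite.symm fun i ↦ (I i : ℕ)
  let c : (Fin n → Fin q) → MvPowerSeries (Fin n) V := fun I J ↦ coeff (q • J + e I) f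
  have hc : ∀ I J, coeff J (c I) = coeff (q • J + e I) f := fun I J ↦ rfl
  -- Sort the monomials of f by their exponents modulo q. The monomial with exponent `e I` is
  -- integral because its q-th power is its own expansion.
  have key : f = ∑ I, monomial (e I) 1 * expand q hq (c I) := by
    ext D
    rw [map_sum]
    let I₀ : Fin n → Fin q := fun i ↦ ⟨D i % q, Nat.mod_lt _ (Nat.pos_of_ne_zero hq)⟩
    let J₀ : Fin n →₀ ℕ := Finsupp.equivFunOnFinite.symm fun i ↦ D i / q
    have hD : q • J₀ + e I₀ = D := by
      ext i
      simp [J₀, e, I₀, Nat.div_add_mod]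
    rw [Finset.sum_eq_single I₀]
    · rw [coeff_monomial_mul, if_pos (by rw [← hD]; exact le_add_self), one_mul]
      rw [show D - e I₀ = q • J₀ by rw [← hD, add_tsub_cancel_right], coeff_expand_smul, hc, hD]
    · intro I _ hI
      rw [coeff_monomial_mul]
      split_ifs with hle
      · rw [one_mul]
        obtain ⟨i, hi⟩ := Function.ne_iff.mp hI
        refine coeff_expand_of_not_dvd q hq (c I) (i := i) fun hdvd ↦ hi ?_
        have h1 : (I i : ℕ) ≤ D i := hle i
        have h2 : q ∣ D i - (I i : ℕ) := hdvd
        ext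
        change (I i : ℕ) = D i % q
        rw [← (Nat.modEq_iff_dvd' h1).mpr h2, Nat.mod_eq_of_lt (I i).2]
      · rfl
    · intro h
      exact absurd (Finset.mem_univ _) h
  rw [key]
  exact RingHom.isIntegralElem_sum_mul (expand (σ := Fin n) (R := V) q hq).toRingHom _ _ c
    (fun I ↦ monomial (e I) 1) (Nat.pos_of_ne_zero hq)
    fun I ↦ by
      change _ = expand q hq (monomial (e I) 1)
      rw [expand_monomial, monomial_pow, one_pow]

end MvPowerSeries

/-! ### The ring R_∞: primality of π, normality, Frobenius and its lift. -/

namespace RInfty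

open MvPowerSeries

variable (p : ℕ) [hp : Fact p.Prime] (n : ℕ) (V : Type u) [CommRing V]

/-- The inclusion of the stage `V[[x^{1/p^m}]]` into `R_∞`. -/
noncomputable def of (m : ℕ) : MvPowerSeries (Fin n) V →+* RInfty p n V :=
  Ring.DirectLimit.of (fun _ : ℕ => MvPowerSeries (Fin n) V)
    (fun m k h => ⇑(rootInclusion p n V m k h)) m

variable {n V}

lemma ofBase_apply (f : MvPowerSeries (Fin n) V) : ofBase p n V f = of p n V 0 f := rfl

lemma rootInclusion_apply (m k : ℕ) (h : m ≤ k) (f : MvPowerSeries (Fin n) V) :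
    rootInclusion p n V m k h f = expand (p ^ (k - m)) (pow_ne_zero _ hp.out.ne_zero) f := rfl

instance directedSystem : DirectedSystem (fun _ : ℕ => MvPowerSeries (Fin n) V)
    (fun m k h => ⇑(rootInclusion p n V m k h)) where
  map_self m f := by
    rw [rootInclusion_apply]
    simp only [Nat.sub_self, pow_zero]
    exact expand_one_apply f
  map_map m k l hmk hkl f := by
    rw [rootInclusion_apply, rootInclusion_apply, rootInclusion_apply, ← expand_mul]
    congr 2
    rw [← pow_add]
    congr 1
    omega

lemma of_injective (m : ℕ) : Function.Injective (of p n V m) :=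
  Ring.DirectLimit.of_injective (f' := fun m k h ↦ rootInclusion p n V m k h)
    (fun _ _ _ ↦ expand_injective _) m

lemma of_add_expand (m k : ℕ) (f : MvPowerSeries (Fin n) V) :
    of p n V (m + k) (expand (p ^ k) (pow_ne_zero _ hp.out.ne_zero) f) = of p n V m f := by
  have := Ring.DirectLimit.of_f (f := fun m k h ↦ ⇑(rootInclusion p n V m k h))
    (Nat.le_add_right m k) f
  change of p n V (m + k) (expand (p ^ (m + k - m)) _ f) = of p n V m f at this
  simpa using this

lemma of_C (m : ℕ) (c : V) : of p n V m (C c) = ofBase p n V (C c) := by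
  rw [ofBase_apply, ← of_add_expand p 0 m, expand_C, zero_add]

variable {p}

lemma exists_of (r : RInfty p n V) : ∃ m f, of p n V m f = r :=
  Ring.DirectLimit.exists_of r

lemma exists_of_le (r : RInfty p n V) : ∃ m, ∀ k, m ≤ k → ∃ f, of p n V k f = r := by
  obtain ⟨m, f, rfl⟩ := exists_of r
  refine ⟨m, fun k hk ↦ ?_⟩
  obtain ⟨l, rfl⟩ := Nat.exists_eq_add_of_le hk
  exact ⟨_, of_add_expand p m l f⟩

lemma exists_of₂ (r s : RInfty p n V) : ∃ m f g, of p n V m f = r ∧ of p n V m g = s := by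
  obtain ⟨m, hm⟩ := exists_of_le r
  obtain ⟨k, hk⟩ := exists_of_le s
  obtain ⟨f, hf⟩ := hm (max m k) (le_max_left _ _)
  obtain ⟨g, hg⟩ := hk (max m k) (le_max_right _ _)
  exact ⟨_, f, g, hf, hg⟩

instance isDomain [IsDomain V] : IsDomain (RInfty p n V) := by
  have : Nontrivial (RInfty p n V) := (of_injective p (n := n) (V := V) 0).nontrivial
  have : NoZeroDivisors (RInfty p n V) := ⟨fun {r s} h ↦ by
    obtain ⟨m, f, g, rfl, rfl⟩ := exists_of₂ r s
    rw [← map_mul, map_eq_zero_iff _ (of_injective p m), mul_eq_zero] at h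
    exact h.imp (fun h ↦ by rw [h, map_zero]) (fun h ↦ by rw [h, map_zero])⟩
  exact NoZeroDivisors.to_isDomain _

/-- A quotient may live at a later stage, but divisibility by a constant is tested on coefficients,
and passing to a later stage only moves these to other exponents. -/
lemma dvd_of_iff {c : V} {m : ℕ} {f : MvPowerSeries (Fin n) V} :
    ofBase p n V (C c) ∣ of p n V m f ↔ C c ∣ f := by
  constructor
  · rintro ⟨t, ht⟩
    obtain ⟨k, hk⟩ := exists_of_le t
    obtain ⟨g, rfl⟩ := hk (m + k) (by omega)
    rw [← of_C p (m + k), ← of_add_expand p m k, ← map_mul] at ht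
    rw [← C_dvd_expand_iff (pow_ne_zero k hp.out.ne_zero), of_injective p _ ht]
    exact dvd_mul_right _ _
  · rintro ⟨g, rfl⟩
    rw [map_mul, of_C]
    exact dvd_mul_right _ _

lemma prime_ofBase_C [IsDomain V] {c : V} (hc : Prime c) : Prime (ofBase p n V (C c)) := by
  have hC := prime_C (σ := Fin n) hc
  refine ⟨?_, ?_, fun r s h ↦ ?_⟩
  · rw [ofBase_apply, Ne, map_eq_zero_iff _ (of_injective p 0)]
    exact hC.ne_zero
  · intro h
    have : ofBase p n V (C c) ∣ of p n V 0 1 := h.dvd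
    rw [dvd_of_iff] at this
    exact hC.not_isUnit (isUnit_of_dvd_one this)
  · obtain ⟨m, f, g, rfl, rfl⟩ := exists_of₂ r s
    rw [← map_mul, dvd_of_iff] at h
    rw [dvd_of_iff, dvd_of_iff]
    exact hC.dvd_or_dvd h

lemma ofBase_isIntegralElem (r : RInfty p n V) : (ofBase p n V).IsIntegralElem r := by
  obtain ⟨m, f, rfl⟩ := exists_of r
  obtain ⟨P, hP, h⟩ := expand_isIntegralElem n (p ^ m) (pow_ne_zero _ hp.out.ne_zero) f
  refine ⟨P, hP, ?_⟩
  have h' := congrArg (of p n V m) h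
  rw [Polynomial.hom_eval₂, map_zero] at h'
  rw [← h']
  congr 1
  ext g : 1
  have := of_add_expand p 0 m g
  rw [zero_add] at this
  exact this.symm

/-- R_∞ is integral over R, so an element integral over R_∞ satisfies a monic equation over R. That
equation can be read in the fraction field of one stage, which is a normal ring. -/
instance isIntegrallyClosed [IsDomain V] [IsNoetherianRing V] [IsIntegrallyClosed V] :
    IsIntegrallyClosed (RInfty p n V) := by
  have hR : IsIntegrallyClosed (MvPowerSeries (Fin n) V) := isIntegrallyClosed_fin n
  have : IsDomain (MvPowerSeries (Fin n) V) := NoZeroDivisors.to_isDomain _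
  let K := FractionRing (RInfty p n V)
  refine (isIntegrallyClosed_iff K).mpr fun {z} hz ↦ ?_
  obtain ⟨u, v, hv, rfl⟩ := IsFractionRing.div_surjective (RInfty p n V) z
  obtain ⟨m, f, g, rfl, rfl⟩ := exists_of₂ u v
  have hg : g ≠ 0 := by
    rintro rfl
    exact nonZeroDivisors.ne_zero hv (map_zero _)
  obtain ⟨P, hP, hP0⟩ : ((algebraMap (RInfty p n V) K).comp (ofBase p n V)).IsIntegralElem
      (algebraMap (RInfty p n V) K (of p n V m f) / algebraMap (RInfty p n V) K (of p n V m g)) :=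
    RingHom.IsIntegralElem.comp_of_isIntegral (fun r ↦ ofBase_isIntegralElem r) hz
  let ι : MvPowerSeries (Fin n) V →+* K := (algebraMap (RInfty p n V) K).comp (of p n V m)
  have hι : Function.Injective ι :=
    (FaithfulSMul.algebraMap_injective (RInfty p n V) K).comp (of_injective p m)
  let ψ : FractionRing (MvPowerSeries (Fin n) V) →+* K := IsFractionRing.lift hι
  have hψ : ∀ x, ψ (algebraMap _ _ x) = ι x := fun x ↦ IsFractionRing.lift_algebraMap hι x
  let y := algebraMap _ (FractionRing (MvPowerSeries (Fin n) V)) f / algebraMap _ _ g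
  have hy : IsIntegral (MvPowerSeries (Fin n) V) y := by
    refine ⟨P.map (expand (p ^ m) (pow_ne_zero _ hp.out.ne_zero)).toRingHom, hP.map _,
      ψ.injective ?_⟩
    rw [Polynomial.eval₂_map, Polynomial.hom_eval₂, map_zero, ← hP0]
    congr 1
    · ext x
      change ψ (algebraMap _ _ (expand (p ^ m) (pow_ne_zero _ hp.out.ne_zero) x)) = _
      rw [hψ]
      have := of_add_expand p 0 m x
      rw [zero_add] at this
      exact congrArg (algebraMap (RInfty p n V) K) this
    · rw [map_div₀, hψ, hψ]
      rfl
  obtain ⟨h, hh⟩ := IsIntegrallyClosed.algebraMap_eq_of_integral hy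
  refine ⟨of p n V m h, ?_⟩
  have := congrArg ψ hh
  rw [hψ, map_div₀, hψ, hψ] at this
  exact this

/-- A p-th root modulo ϖ: one stage further the variables have p-th roots, and c^(p^e) is a p-th
root of a coefficient c because c^(p^(e+1)) ≡ c. -/
lemma dvd_pow_sub [IsDomain V] {ϖ : V} {e : ℕ} (hϖ : Prime ϖ) (hpϖ : ϖ ∣ (p : V))
    (hq : ∀ x : V, ϖ ∣ x ^ p ^ (e + 1) - x) (r : RInfty p n V) :
    ∃ s, ofBase p n V (C ϖ) ∣ s ^ p - r := by
  have : (Ideal.span {ϖ}).IsPrime := (Ideal.span_singleton_prime hϖ.ne_zero).mpr hϖ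
  have : CharP (V ⧸ Ideal.span {ϖ}) p := charP_quotient_span_singleton hϖ.not_isUnit hp.out hpϖ
  obtain ⟨m, f, rfl⟩ := exists_of r
  let g : MvPowerSeries (Fin n) V := fun d ↦ coeff d f ^ p ^ e
  refine ⟨of p n V (m + 1) g, ?_⟩
  rw [← of_add_expand p m 1 f, ← map_pow, ← map_sub, dvd_of_iff, C_dvd_sub_iff, map_pow,
    ← map_frobenius_expand p hp.out.ne_zero, map_expand, map_expand]
  simp only [pow_one]
  congr 1
  ext d
  rw [coeff_map, coeff_map, coeff_map, frobenius_def, ← map_pow]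
  rw [Ideal.Quotient.eq, Ideal.mem_span_singleton]
  have := hq (coeff d f)
  rwa [pow_succ, pow_mul] at this

/-- The `V`-linear endomorphism of `R_∞` that raises the variables to their `q`-th powers. -/
noncomputable def powVars (p : ℕ) [hp : Fact p.Prime] (n : ℕ) (V : Type u) [CommRing V] (q : ℕ)
    (hq : q ≠ 0) : RInfty p n V →+* RInfty p n V :=
  Ring.DirectLimit.map (f := fun m k h ↦ rootInclusion p n V m k h)
    (f' := fun m k h ↦ rootInclusion p n V m k h)
    (fun _ ↦ (expand q hq).toRingHom) (fun m k h ↦ by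
      ext f : 1
      change expand q hq (expand (p ^ (k - m)) (pow_ne_zero _ hp.out.ne_zero) f) =
        expand (p ^ (k - m)) (pow_ne_zero _ hp.out.ne_zero) (expand q hq f)
      rw [← expand_mul, ← expand_mul]
      congr 2
      exact mul_comm _ _)

lemma powVars_of {q : ℕ} (hq : q ≠ 0) (m : ℕ) (f : MvPowerSeries (Fin n) V) :
    powVars p n V q hq (of p n V m f) = of p n V m (expand q hq f) :=
  Ring.DirectLimit.map_apply_of _ _ _

lemma powVars_bijective (e : ℕ) :
    Function.Bijective (powVars p n V (p ^ e) (pow_ne_zero _ hp.out.ne_zero)) := by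
  constructor
  · rw [injective_iff_map_eq_zero]
    intro r hr
    obtain ⟨m, f, rfl⟩ := exists_of r
    rw [powVars_of, map_eq_zero_iff _ (of_injective p m),
      map_eq_zero_iff _ (expand_injective _)] at hr
    rw [hr, map_zero]
  · intro r
    obtain ⟨m, f, rfl⟩ := exists_of r
    exact ⟨of p n V (m + e) f, by rw [powVars_of, of_add_expand]⟩

lemma powVars_ofBase_C {q : ℕ} (hq : q ≠ 0) (c : V) :
    powVars p n V q hq (ofBase p n V (C c)) = ofBase p n V (C c) := by
  rw [ofBase_apply, powVars_of, expand_C]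

/-- In characteristic p, the p^e-th power of a series raises both the variables and the coefficients
to that power, and modulo ϖ the coefficients do not change. -/
lemma dvd_powVars_sub_pow [IsDomain V] {ϖ : V} {e : ℕ} (hϖ : Prime ϖ) (hpϖ : ϖ ∣ (p : V))
    (hq : ∀ x : V, ϖ ∣ x ^ p ^ e - x) (r : RInfty p n V) :
    ofBase p n V (C ϖ) ∣
      powVars p n V (p ^ e) (pow_ne_zero _ hp.out.ne_zero) r - r ^ p ^ e := by
  have : (Ideal.span {ϖ}).IsPrime := (Ideal.span_singleton_prime hϖ.ne_zero).mpr hϖ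
  have : CharP (V ⧸ Ideal.span {ϖ}) p := charP_quotient_span_singleton hϖ.not_isUnit hp.out hpϖ
  obtain ⟨m, f, rfl⟩ := exists_of r
  rw [powVars_of, ← map_pow, ← map_sub, dvd_of_iff, C_dvd_sub_iff, map_pow,
    ← map_iterateFrobenius_expand p hp.out.ne_zero, map_expand]
  ext d
  rw [coeff_map]
  generalize (coeff d) (expand (p ^ e) (pow_ne_zero _ hp.out.ne_zero)
    ((map (Ideal.Quotient.mk (Ideal.span {ϖ}))) f)) = x
  obtain ⟨x, rfl⟩ := Ideal.Quotient.mk_surjective x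
  rw [iterateFrobenius_def, ← map_pow, eq_comm, Ideal.Quotient.eq, Ideal.mem_span_singleton]
  exact hq x

/-- Otherwise (ϖ, a) would be principal, of height at most 1 by Krull. -/
lemma not_ofBase_C_dvd [IsDomain V] [IsNoetherianRing V] {ϖ : V} (hϖ : Prime ϖ)
    {a : MvPowerSeries (Fin n) V} (hht : (Ideal.span {C ϖ, a}).height = 2) :
    ¬ ofBase p n V (C ϖ) ∣ ofBase p n V a := by
  rw [ofBase_apply p a, dvd_of_iff]
  intro h
  have : IsDomain (MvPowerSeries (Fin n) V) := NoZeroDivisors.to_isDomain _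
  have h1 : Ideal.span {C ϖ, a} = Ideal.span {C ϖ} := by
    rw [Ideal.span_insert, sup_eq_left, Ideal.span_singleton_le_span_singleton]
    exact h
  rw [h1] at hht
  have h2 := Ideal.height_span_singleton_le_one (prime_C (σ := Fin n) hϖ).not_isUnit
  rw [hht] at h2
  exact absurd h2 (by decide)

/-- R_∞ is integral over R, so it maps to the algebraically closed field over R. The map is
injective since every nonzero element of R_∞ divides a nonzero element of R. -/
lemma exists_isEmbeddingOver [IsDomain V] {S : Type v} [CommRing S] [IsDomain S]
    [Algebra (MvPowerSeries (Fin n) V) S]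
    (hRS : Function.Injective (algebraMap (MvPowerSeries (Fin n) V) S)) :
    ∃ i : RInfty p n V →+* AbsoluteIntegralClosure S, IsEmbeddingOver p n i := by
  have : IsDomain (MvPowerSeries (Fin n) V) := NoZeroDivisors.to_isDomain _
  let Ω := AlgebraicClosure (FractionRing S)
  algebraize [ofBase p n V]
  have hinj : Function.Injective (algebraMap (MvPowerSeries (Fin n) V) (RInfty p n V)) :=
    of_injective p 0
  have : Algebra.IsIntegral (MvPowerSeries (Fin n) V) (RInfty p n V) :=
    ⟨fun r ↦ ofBase_isIntegralElem r⟩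
  have : FaithfulSMul (MvPowerSeries (Fin n) V) (RInfty p n V) :=
    (faithfulSMul_iff_algebraMap_injective _ _).mpr hinj
  have : FaithfulSMul (MvPowerSeries (Fin n) V) S :=
    (faithfulSMul_iff_algebraMap_injective _ _).mpr hRS
  have : FaithfulSMul (MvPowerSeries (Fin n) V) Ω := by
    rw [faithfulSMul_iff_algebraMap_injective, IsScalarTower.algebraMap_eq _ S Ω]
    exact (algebraMap_algebraicClosure_injective S).comp hRS
  let ψ : RInfty p n V →ₐ[MvPowerSeries (Fin n) V] Ω := IsAlgClosed.lift
  have hψ : ∀ r, ψ r ∈ integralClosure S Ω := fun r ↦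
    ((Algebra.IsIntegral.isIntegral (R := MvPowerSeries (Fin n) V) r).map ψ).tower_top
  refine ⟨ψ.toRingHom.codRestrict (integralClosure S Ω) hψ, ?_, ?_⟩
  · rw [RingHom.injective_codRestrict]
    rw [injective_iff_map_eq_zero]
    intro r hr
    by_contra hr0
    obtain ⟨c, hc0, hc⟩ := (Algebra.IsIntegral.isIntegral
      (R := MvPowerSeries (Fin n) V) r).isAlgebraic.exists_nonzero_dvd
        (mem_nonZeroDivisors_of_ne_zero hr0)
    obtain ⟨t, ht⟩ := hc
    have h3 := congrArg ψ ht
    rw [map_mul, show ψ r = 0 from hr, zero_mul, ψ.commutes] at h3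
    exact hc0 ((FaithfulSMul.algebraMap_injective (MvPowerSeries (Fin n) V) Ω)
      (h3.trans (map_zero _).symm))
  · ext f
    exact (ψ.commutes f).trans (IsScalarTower.algebraMap_apply _ S Ω f)

end RInfty

/-! ### Galois coordinates: étaleness and Frobenius up to the factor m. -/

section GaloisCoordinates

open TensorProduct

/-- A finite family of `A`-algebra endomorphisms of `B` that add up to a trace `B → A`, and
elements `x i`, `y i` of `B` with `∑ x i * g (y i)` equal to `m ∈ A` for `g = 1` and to `0`
otherwise. If `m` is invertible this exhibits `B` as a finite étale `A`-algebra. -/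
structure GaloisCoordinates (A B G ι : Type*) [CommRing A] [CommRing B] [Algebra A B] [Fintype G]
    [Fintype ι] where
  act : G → B →ₐ[A] B
  one : G
  act_one : act one = AlgHom.id A B
  tr : B →ₗ[A] A
  algebraMap_tr : ∀ b, algebraMap A B (tr b) = ∑ g, act g b
  x : ι → B
  y : ι → B
  m : A
  sum_one : ∑ i, x i * y i = algebraMap A B m
  sum_ne_one : ∀ g, g ≠ one → ∑ i, x i * act g (y i) = 0

namespace GaloisCoordinates

variable {A B G ι : Type*} [CommRing A] [CommRing B] [Algebra A B] [Fintype G] [Fintype ι]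
  (D : GaloisCoordinates A B G ι)

lemma sum_act [DecidableEq G] (g : G) :
    ∑ i, D.x i * D.act g (D.y i) = if g = D.one then algebraMap A B D.m else 0 := by
  split_ifs with h
  · rw [h, D.act_one]
    exact D.sum_one
  · exact D.sum_ne_one g h

/-- Up to m the families x and y are dual bases for the trace form: write the trace as a sum over g
and exchange the sums, and orthogonality leaves only the term of `one`. -/
lemma sum_tr_smul (b : B) : ∑ i, D.tr (b * D.y i) • D.x i = D.m • b := by
  classical
  simp_rw [Algebra.smul_def, D.algebraMap_tr, Finset.sum_mul, map_mul]
  rw [Finset.sum_comm]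
  have : ∀ g, ∑ i, D.act g b * D.act g (D.y i) * D.x i =
      D.act g b * if g = D.one then algebraMap A B D.m else 0 := by
    intro g
    rw [← D.sum_act, Finset.mul_sum]
    exact Finset.sum_congr rfl fun i _ ↦ by ring
  simp_rw [this, mul_ite, mul_zero]
  rw [Finset.sum_ite_eq' Finset.univ D.one, if_pos (Finset.mem_univ _), D.act_one, mul_comm]
  rfl

/-- Multiplying by `b` on either side of `∑ x i ⊗ y i` gives the same result up to `m`. -/
lemma smul_tmul_mul (b : B) :
    D.m • ∑ i, (b * D.x i) ⊗ₜ[A] D.y i = D.m • ∑ i, D.x i ⊗ₜ[A] (b * D.y i) := by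
  classical
  -- Expanding the second tensor factor by the trace identity gives a right side that depends on c
  -- and d only through c * d. Compare (b, 1) with (1, b).
  have key : ∀ c d : B, D.m • ∑ j, (c * D.x j) ⊗ₜ[A] (d * D.y j) =
      ∑ i, (c * d * D.y i * algebraMap A B D.m) ⊗ₜ[A] D.x i := by
    intro c d
    have h1 : ∀ j, D.m • ((c * D.x j) ⊗ₜ[A] (d * D.y j)) =
        ∑ i, (D.tr (d * D.y j * D.y i) • (c * D.x j)) ⊗ₜ[A] D.x i := by
      intro j
      rw [← tmul_smul, ← D.sum_tr_smul, tmul_sum]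
      exact Finset.sum_congr rfl fun i _ ↦ by rw [tmul_smul, smul_tmul']
    rw [Finset.smul_sum, Finset.sum_congr rfl fun j _ ↦ h1 j, Finset.sum_comm]
    refine Finset.sum_congr rfl fun i _ ↦ ?_
    rw [← sum_tmul]
    congr 1
    simp_rw [Algebra.smul_def, D.algebraMap_tr, Finset.sum_mul, map_mul]
    rw [Finset.sum_comm]
    have : ∀ g, ∑ j, D.act g d * D.act g (D.y j) * D.act g (D.y i) * (c * D.x j) =
        c * D.act g d * D.act g (D.y i) * if g = D.one then algebraMap A B D.m else 0 := by
      intro g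
      rw [← D.sum_act, Finset.mul_sum]
      exact Finset.sum_congr rfl fun i _ ↦ by ring
    simp_rw [this, mul_ite, mul_zero]
    rw [Finset.sum_ite_eq' Finset.univ D.one, if_pos (Finset.mem_univ _), D.act_one]
    rfl
  have h1 := key b 1
  have h2 := key 1 b
  simp only [one_mul, mul_one] at h1 h2
  rw [h1, h2]

section BaseChange

variable (Q E : Type*) [CommRing Q] [CommRing E] [Algebra A Q] [Algebra Q E] [Algebra A E]
  [Algebra B E] [IsScalarTower A Q E] [IsScalarTower A B E] [h : Algebra.IsPushout A Q B E]

include h in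
-- The base-changed trace identity, divided by m, makes E a retract of a finite free module, hence
-- finite projective.
lemma exists_dual (hm : IsUnit (algebraMap A Q D.m)) :
    ∃ (s : E →ₗ[Q] (ι → Q)) (r : (ι → Q) →ₗ[Q] E), r ∘ₗ s = LinearMap.id := by
  let l : ι → (E →ₗ[Q] Q) := fun i ↦ h.out.lift
    (Algebra.linearMap A Q ∘ₗ D.tr ∘ₗ LinearMap.mulRight A (D.y i))
  have hl : ∀ i b, l i (algebraMap B E b) = algebraMap A Q (D.tr (b * D.y i)) := fun i b ↦
    h.out.lift_eq _ b
  let r : (ι → Q) →ₗ[Q] E := Fintype.linearCombination Q fun i ↦ algebraMap B E (D.x i)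
  obtain ⟨u, hu⟩ := hm
  refine ⟨(↑u⁻¹ : Q) • LinearMap.pi l, r, ?_⟩
  refine h.out.algHom_ext _ _ fun b ↦ ?_
  change r ((↑u⁻¹ : Q) • LinearMap.pi l (algebraMap B E b)) = algebraMap B E b
  rw [map_smul, Fintype.linearCombination_apply]
  simp only [LinearMap.pi_apply, hl]
  have h1 : ∑ i, algebraMap A Q (D.tr (b * D.y i)) • algebraMap B E (D.x i) =
      (u : Q) • algebraMap B E b := by
    have := congrArg (algebraMap B E) (D.sum_tr_smul b)
    simp only [map_sum, Algebra.smul_def, map_mul] at this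
    simp only [Algebra.smul_def, ← IsScalarTower.algebraMap_apply, hu] at this ⊢
    exact this
  rw [h1, smul_smul, Units.inv_mul, one_smul]

include h in
-- The element is m⁻¹ Σ x_i ⊗ y_i. It is annihilated by 1 ⊗ s - s ⊗ 1 for s from B, and so for all s
-- by Q-linearity.
lemma exists_separability_element (hm : IsUnit (algebraMap A Q D.m)) :
    ∃ t : E ⊗[Q] E, (∀ s, ((1 : E) ⊗ₜ[Q] s - s ⊗ₜ[Q] (1 : E)) * t = 0) ∧
      Algebra.TensorProduct.lmul' Q t = 1 := by
  obtain ⟨u, hu⟩ := hm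
  let t₀ : E ⊗[Q] E := ∑ i, algebraMap B E (D.x i) ⊗ₜ[Q] algebraMap B E (D.y i)
  let f : B →ₐ[A] E ⊗[Q] E :=
    ((Algebra.TensorProduct.includeLeft : E →ₐ[Q] E ⊗[Q] E).restrictScalars A).comp
    (IsScalarTower.toAlgHom A B E)
  let g : B →ₐ[A] E ⊗[Q] E :=
    ((Algebra.TensorProduct.includeRight : E →ₐ[Q] E ⊗[Q] E).restrictScalars A).comp
    (IsScalarTower.toAlgHom A B E)
  let fg : B ⊗[A] B →ₐ[A] E ⊗[Q] E := Algebra.TensorProduct.lift f g fun _ _ ↦ Commute.all _ _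
  have hfg : ∀ b c, fg (b ⊗ₜ c) = algebraMap B E b ⊗ₜ algebraMap B E c := by
    intro b c
    change (algebraMap B E b ⊗ₜ[Q] (1 : E)) * ((1 : E) ⊗ₜ[Q] algebraMap B E c) = _
    rw [Algebra.TensorProduct.tmul_mul_tmul, mul_one, one_mul]
  have hsm : ∀ z : E ⊗[Q] E, D.m • z = (u : Q) • z := fun z ↦ by rw [hu, algebraMap_smul]
  have hB : ∀ b, ((1 : E) ⊗ₜ[Q] algebraMap B E b - algebraMap B E b ⊗ₜ[Q] (1 : E)) * t₀ = 0 := by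
    intro b
    have h1 := congrArg fg (D.smul_tmul_mul b)
    rw [map_smul, map_smul, map_sum, map_sum, hsm, hsm] at h1
    have h2 := congrArg ((↑u⁻¹ : Q) • ·) h1
    simp only [smul_smul, Units.inv_mul, one_smul] at h2
    simp only [hfg, map_mul] at h2
    rw [sub_mul, Finset.mul_sum, Finset.mul_sum, sub_eq_zero]
    simp only [Algebra.TensorProduct.tmul_mul_tmul, one_mul]
    exact h2.symm
  have hE : ∀ s, ((1 : E) ⊗ₜ[Q] s - s ⊗ₜ[Q] (1 : E)) * t₀ = 0 := by
    intro s
    induction s using h.out.inductionOn with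
    | zero => simp
    | tmul b => exact hB b
    | smul q s hs =>
      rw [tmul_smul, ← smul_tmul', ← smul_sub, smul_mul_assoc, hs, smul_zero]
    | add s s' hs hs' =>
      rw [tmul_add, add_tmul, add_sub_add_comm, add_mul, hs, hs', add_zero]
  refine ⟨(↑u⁻¹ : Q) • t₀, fun s ↦ by rw [mul_smul_comm, hE, smul_zero], ?_⟩
  rw [map_smul, map_sum]
  have h3 := congrArg (algebraMap B E) D.sum_one
  rw [map_sum, ← IsScalarTower.algebraMap_apply, IsScalarTower.algebraMap_apply A Q E, ← hu] at h3
  simp only [map_mul] at h3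
  simp only [Algebra.TensorProduct.lmul'_apply_tmul, h3]
  rw [Algebra.smul_def, ← map_mul, Units.inv_mul, map_one]

include D h in
-- Projectivity gives flatness and finite presentation, and the separability element gives that the
-- algebra is unramified.
theorem finite_and_etale (hm : IsUnit (algebraMap A Q D.m)) :
    Module.Finite Q E ∧ Algebra.Etale Q E := by
  obtain ⟨s, r, hrs⟩ := D.exists_dual Q E hm
  have hr : Function.Surjective r := fun e ↦ ⟨s e, LinearMap.congr_fun hrs e⟩
  have : Module.Finite Q E := .of_surjective r hr
  have : Module.Projective Q E := .of_split s r hrs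
  have : Module.FinitePresentation Q E := Module.finitePresentation_of_projective Q E
  have : Algebra.FinitePresentation Q E := inferInstance
  have : Algebra.FormallyUnramified Q E :=
    Algebra.FormallyUnramified.iff_exists_tensorProduct.mpr (D.exists_separability_element Q E hm)
  exact ⟨inferInstance, .of_formallyUnramified_of_flat⟩

end BaseChange

section Frobenius

variable {p : ℕ} [Fact p.Prime] {π : A} [CharP (B ⧸ Ideal.span {algebraMap A B π}) p]

/-- If Frobenius is surjective on `A/π`, then it is surjective on `B/π` up to `m`. -/
lemma exists_pow_congr (hA : ∀ r : A, ∃ s, π ∣ s ^ p - r) (b : B) :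
    ∃ s, algebraMap A B π ∣ algebraMap A B D.m ^ p * b - s ^ p := by
  classical
  choose ρ hρ using hA
  let mk := Ideal.Quotient.mk (Ideal.span {algebraMap A B π})
  have hmk : ∀ r : A, mk (algebraMap A B (ρ r)) ^ p = mk (algebraMap A B r) := by
    intro r
    rw [← map_pow, Ideal.Quotient.eq, Ideal.mem_span_singleton, ← map_pow, ← map_sub]
    exact map_dvd _ (hρ r)
  -- The p-th power of this sum is Σ tr(b y_i^p) x_i^p modulo π, and this is m^p b by the p-th
  -- powers of the orthogonality relations.
  refine ⟨∑ i, algebraMap A B (ρ (D.tr (b * D.y i ^ p))) * D.x i, ?_⟩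
  rw [← Ideal.mem_span_singleton, ← Ideal.Quotient.eq]
  change mk _ = mk _
  rw [map_pow, map_sum, sum_pow_char p]
  simp_rw [map_mul, mul_pow, hmk, D.algebraMap_tr, map_sum, map_mul, Finset.sum_mul, map_pow]
  rw [Finset.sum_comm]
  have : ∀ g, ∑ i, mk (D.act g b) * mk (D.act g (D.y i)) ^ p * mk (D.x i) ^ p =
      if g = D.one then mk (D.act g b) * mk (algebraMap A B D.m) ^ p else 0 := by
    intro g
    have h1 := congrArg (fun z ↦ mk z ^ p) (D.sum_act g)
    simp only [map_sum, sum_pow_char p, map_mul, mul_pow] at h1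
    have h2 : ∑ i, mk (D.act g b) * mk (D.act g (D.y i)) ^ p * mk (D.x i) ^ p =
        mk (D.act g b) * ∑ i, mk (D.x i) ^ p * mk (D.act g (D.y i)) ^ p := by
      rw [Finset.mul_sum]
      exact Finset.sum_congr rfl fun i _ ↦ by ring
    rw [h2, h1]
    split_ifs
    · rfl
    · rw [map_zero, zero_pow (Fact.out : p.Prime).ne_zero, mul_zero]
  simp_rw [this]
  rw [Finset.sum_ite_eq' Finset.univ D.one, if_pos (Finset.mem_univ _), D.act_one, mul_comm]
  rfl

/-- `B/π` is reduced up to `m`. -/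
lemma dvd_mul_of_dvd_pow (hπ : Prime π)
    (hdvd : ∀ r : A, algebraMap A B π ∣ algebraMap A B r → π ∣ r) {b : B}
    (hb : algebraMap A B π ∣ b ^ p) : algebraMap A B π ∣ algebraMap A B D.m * b := by
  rw [← Algebra.smul_def, ← D.sum_tr_smul]
  refine Finset.dvd_sum fun i _ ↦ ?_
  rw [Algebra.smul_def]
  refine Dvd.dvd.mul_right (map_dvd _ ?_) _
  -- Modulo π, the p-th power of tr(b y_i) is the sum of the g(b^p y_i^p), each of which is
  -- divisible by π because g fixes π.
  refine hπ.dvd_of_dvd_pow (n := p) (hdvd _ ?_)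
  let mk := Ideal.Quotient.mk (Ideal.span {algebraMap A B π})
  rw [← Ideal.mem_span_singleton, ← Ideal.Quotient.eq_zero_iff_mem]
  change mk _ = 0
  rw [map_pow, map_pow, D.algebraMap_tr, map_sum, sum_pow_char p]
  refine Finset.sum_eq_zero fun g _ ↦ ?_
  obtain ⟨c, hc⟩ := hb
  rw [← map_pow, ← map_pow, mul_pow, hc, mul_assoc, map_mul, AlgHom.commutes, map_mul]
  rw [show mk (algebraMap A B π) = 0 from
    Ideal.Quotient.eq_zero_iff_mem.mpr (Ideal.mem_span_singleton_self _), zero_mul]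

end Frobenius

end GaloisCoordinates

end GaloisCoordinates

/-! ### Algebras as filtered colimits of subalgebras. -/

section Ind

open Limits

variable {A : Type u} {B : Type v} [CommRing A] [CommRing B] [Algebra A B]

/-- The diagram formed by a set of subalgebras and their inclusions. -/
def Subalgebra.diagram (𝒮 : Set (Subalgebra A B)) : 𝒮 ⥤ CommAlgCat.{v} A where
  obj C := CommAlgCat.of A C.1
  map f := CommAlgCat.ofHom (Subalgebra.inclusion (leOfHom f))

/-- The components of a cocone over `Subalgebra.diagram` as algebra homomorphisms. -/
def Subalgebra.diagramCoconeHom {𝒮 : Set (Subalgebra A B)} (s : Cocone (Subalgebra.diagram 𝒮))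
    (C : 𝒮) : C.1 →ₐ[A] s.pt :=
  CommAlgCat.Hom.hom (A := CommAlgCat.of A C.1) (B := s.pt) (s.ι.app C)

lemma Subalgebra.diagramCoconeHom_comp {𝒮 : Set (Subalgebra A B)}
    (s : Cocone (Subalgebra.diagram 𝒮)) (C C' : 𝒮) (h : C.1 ≤ C'.1) :
    diagramCoconeHom s C = (diagramCoconeHom s C').comp (Subalgebra.inclusion h) :=
  (congrArg CommAlgCat.Hom.hom (s.ι.naturality (homOfLE h : C ⟶ C'))).symm

/-- An algebra is the colimit of a directed family of subalgebras that covers it. -/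
noncomputable def Subalgebra.colimitPresentation (𝒮 : Set (Subalgebra A B)) [Nonempty 𝒮]
    (hdir : DirectedOn (· ≤ ·) 𝒮) (hcov : ∀ b, ∃ C ∈ 𝒮, b ∈ C) :
    ColimitPresentation 𝒮 (CommAlgCat.of A B) where
  diag := Subalgebra.diagram 𝒮
  ι := { app C := CommAlgCat.ofHom C.1.val }
  isColimit :=
    have hd : Directed (· ≤ ·) fun C : 𝒮 ↦ C.1 := hdir.directed_val
    have htop : (⊤ : Subalgebra A B) = ⨆ C : 𝒮, C.1 := by
      refine (eq_top_iff.mpr fun b _ ↦ ?_).symm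
      obtain ⟨C, hC, hb⟩ := hcov b
      exact (le_iSup (fun C : 𝒮 ↦ C.1) ⟨C, hC⟩) hb
    { desc s := CommAlgCat.ofHom ((Subalgebra.iSupLift (B := s.pt) (fun C : 𝒮 ↦ C.1) hd
          (Subalgebra.diagramCoconeHom s)
          (Subalgebra.diagramCoconeHom_comp s) ⊤ htop.le).comp Subalgebra.topEquiv.symm.toAlgHom)
      fac s C := by
        ext b
        exact Subalgebra.iSupLift_of_mem (K := fun C : 𝒮 ↦ C.1) (T := ⊤) (dir := hd)
          (hf := Subalgebra.diagramCoconeHom_comp s) (hT := htop.le) (i := C)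
          (Subalgebra.topEquiv.symm b.1) b.2
      uniq s m hm := by
        ext b
        obtain ⟨C, hC, hb⟩ := hcov b
        have h1 := congrArg (fun f ↦ CommAlgCat.Hom.hom f (⟨b, hb⟩ : C)) (hm ⟨C, hC⟩)
        refine Eq.trans h1 (Eq.symm ?_)
        exact Subalgebra.iSupLift_of_mem (K := fun C : 𝒮 ↦ C.1) (T := ⊤) (dir := hd)
          (hf := Subalgebra.diagramCoconeHom_comp s) (hT := htop.le) (i := ⟨C, hC⟩)
          (Subalgebra.topEquiv.symm b) hb }

end Ind

lemma IsIndFiniteEtale.of_directedOn {A : Type u} {B : Type v} [CommRing A] [CommRing B]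
    (f : A →+* B) (𝒮 : letI := f.toAlgebra; Set (Subalgebra A B)) (hne : 𝒮.Nonempty)
    (hdir : letI := f.toAlgebra; DirectedOn (· ≤ ·) 𝒮)
    (hcov : letI := f.toAlgebra; ∀ b, ∃ C ∈ 𝒮, b ∈ C)
    (h𝒮 : letI := f.toAlgebra; ∀ C ∈ 𝒮, Module.Finite A C ∧ Algebra.Etale A C) :
    IsIndFiniteEtale f := by
  let := f.toAlgebra
  have : Nonempty 𝒮 := hne.to_subtype
  have : IsDirectedOrder 𝒮 := ⟨fun C C' ↦ by
    obtain ⟨C'', h, h1, h2⟩ := hdir C C.2 C' C'.2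
    exact ⟨⟨C'', h⟩, h1, h2⟩⟩
  exact ⟨𝒮, inferInstance, inferInstance, Subalgebra.colimitPresentation 𝒮 hdir hcov,
    fun C ↦ h𝒮 C.1 C.2⟩

/-! ### The pair π, a in integral extensions of a normal domain. -/

section RegularSequence

lemma Prime.pow_dvd_of_dvd_mul_pow {A : Type*} [CommRing A] [IsDomain A] {π a : A} (hπ : Prime π)
    (ha : ¬ π ∣ a) {k l : ℕ} {u : A} (h : π ^ k ∣ a ^ l * u) : π ^ k ∣ u :=
  hπ.pow_dvd_of_dvd_mul_left k (fun h ↦ ha (hπ.dvd_of_dvd_pow h)) h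

variable {A : Type*} [CommRing A] [IsDomain A] [IsIntegrallyClosed A] (K : Type*) [Field K]
  [Algebra A K] [IsFractionRing A K] {Ω : Type*} [Field Ω] [Algebra K Ω] [Algebra A Ω]
  [IsScalarTower A K Ω] [Algebra.IsAlgebraic K Ω]

include K in
-- Scaling z by r multiplies the i-th coefficient of its minimal polynomial by r^(deg - i), and the
-- minimal polynomial of an integral element has coefficients in the normal ring A.
lemma exists_algebraMap_eq_coeff_minpoly_mul {r : A} (hr : r ≠ 0) {z : Ω}
    (hz : IsIntegral A (algebraMap A Ω r * z)) (i : ℕ) :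
    ∃ c : A, algebraMap A K c =
      (minpoly K z).coeff i * algebraMap A K r ^ ((minpoly K z).natDegree - i) := by
  have hr' : algebraMap A K r ≠ 0 :=
    (map_ne_zero_iff _ (FaithfulSMul.algebraMap_injective A K)).mpr hr
  have h1 := IsIntegrallyClosed.minpoly_smul hr' (Algebra.IsIntegral.isIntegral (R := K) z)
  rw [Algebra.smul_def, ← IsScalarTower.algebraMap_apply,
    minpoly.isIntegrallyClosed_eq_field_fractions' K hz] at h1
  have h2 := congrArg (fun P ↦ Polynomial.coeff P i) h1
  simp only [Polynomial.coeff_map, Polynomial.coeff_scaleRoots] at h2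
  exact ⟨_, h2⟩

include K in
/-- In an integrally closed domain, elements of `A[1/π] ∩ A[1/a]` are integral if `π` is prime and
does not divide `a`; this carries over to algebraic extensions. -/
lemma isIntegral_of_isIntegral_mul {π a : A} (hπ : Prime π) (ha : ¬ π ∣ a) {z : Ω}
    (h1 : IsIntegral A (algebraMap A Ω π * z)) (h2 : IsIntegral A (algebraMap A Ω a * z)) :
    IsIntegral A z := by
  have ha0 : a ≠ 0 := by
    rintro rfl
    exact ha (dvd_zero _)
  have hinj := FaithfulSMul.algebraMap_injective A K
  have key : ∀ i, (minpoly K z).coeff i ∈ (algebraMap A K).range := by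
    intro i
    obtain ⟨c, hc⟩ := exists_algebraMap_eq_coeff_minpoly_mul K hπ.ne_zero h1 i
    obtain ⟨d, hd⟩ := exists_algebraMap_eq_coeff_minpoly_mul K ha0 h2 i
    set k := (minpoly K z).natDegree - i
    -- Both sides are (π a)^k times the coefficient. As π is prime and does not divide a, π^k
    -- divides c, so the coefficient lies in A.
    have h3 : a ^ k * c = π ^ k * d := by
      apply hinj
      rw [map_mul, map_mul, map_pow, map_pow, hc, hd]
      ring
    obtain ⟨e, he⟩ := hπ.pow_dvd_of_dvd_mul_pow ha (Dvd.intro d h3.symm)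
    refine ⟨e, ?_⟩
    have h4 : algebraMap A K π ^ k ≠ 0 :=
      pow_ne_zero _ ((map_ne_zero_iff _ hinj).mpr hπ.ne_zero)
    apply mul_right_cancel₀ h4
    rw [← hc, he, map_mul, map_pow, mul_comm]
  obtain ⟨P, hP, -, hPm⟩ := Polynomial.lifts_and_natDegree_eq_and_monic
    ((Polynomial.lifts_iff_coeff_lifts _).mpr fun i ↦ key i)
    (minpoly.monic (Algebra.IsIntegral.isIntegral (R := K) z))
  refine ⟨P, hPm, ?_⟩
  have := minpoly.aeval K z
  rw [← hP, Polynomial.aeval_map_algebraMap] at this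
  exact this

end RegularSequence

/-! ### Galois families: composita, conjugates and semilinear images. -/

section GaloisFamily

/-- The image of `m` in `(A/π)[1/a]` is a unit. -/
def IsUnitModAway {A : Type*} [CommRing A] (π a m : A) : Prop :=
  ∃ (k : ℕ) (c : A), π ∣ a ^ k - m * c

namespace IsUnitModAway

variable {A : Type*} [CommRing A] {π a m m' : A}

lemma one : IsUnitModAway π a 1 := ⟨0, 1, by simp⟩

lemma pow_self (k : ℕ) : IsUnitModAway π a (a ^ k) := ⟨k, 1, by simp⟩

lemma mul (h : IsUnitModAway π a m) (h' : IsUnitModAway π a m') :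
    IsUnitModAway π a (m * m') := by
  obtain ⟨k, c, hk⟩ := h
  obtain ⟨l, d, hl⟩ := h'
  refine ⟨k + l, c * d, ?_⟩
  have : a ^ (k + l) - m * m' * (c * d) = (a ^ k - m * c) * a ^ l + m * c * (a ^ l - m' * d) := by
    ring
  rw [this]
  exact dvd_add (hk.mul_right _) (hl.mul_left _)

lemma ne_zero [IsDomain A] (hπ : Prime π) (ha : ¬ π ∣ a) (h : IsUnitModAway π a m) : m ≠ 0 := by
  rintro rfl
  obtain ⟨k, c, hk⟩ := h
  rw [zero_mul, sub_zero] at hk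
  exact ha (hπ.dvd_of_dvd_pow hk)

/-- A lift `φ` of the `q`-th power map preserves the elements that become units. -/
lemma map_of_dvd_sub_pow {φ : A ≃+* A} {q : ℕ} (hφπ : φ π = π) (hφ : ∀ r, π ∣ φ r - r ^ q)
    (h : IsUnitModAway π a m) : IsUnitModAway π a (φ m) := by
  obtain ⟨k, c, hk⟩ := h
  refine ⟨q * k, φ c, ?_⟩
  have h1 := map_dvd φ hk
  rw [hφπ, map_sub, map_pow, map_mul] at h1
  have h2 : π ∣ (a ^ q) ^ k - φ a ^ k := by
    rw [← dvd_neg, neg_sub]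
    exact (hφ a).trans (sub_dvd_pow_sub_pow _ _ _)
  rw [pow_mul]
  have := dvd_add h2 h1
  rwa [sub_add_sub_cancel] at this

/-- Modulo π the q-th power of φ⁻¹(m) is m, so φ⁻¹(m) divides m, which divides a power of a. -/
lemma symm_map_of_dvd_sub_pow {φ : A ≃+* A} {q : ℕ} (hq : q ≠ 0)
    (hφ : ∀ r, π ∣ φ r - r ^ q) (h : IsUnitModAway π a m) : IsUnitModAway π a (φ.symm m) := by
  obtain ⟨k, c, hk⟩ := h
  obtain ⟨q, rfl⟩ : ∃ q', q = q' + 1 := Nat.exists_eq_succ_of_ne_zero hq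
  have h1 : ∀ r, π ∣ r - φ.symm r ^ (q + 1) := fun r ↦ by simpa using hφ (φ.symm r)
  refine ⟨k, φ.symm m ^ q * φ.symm c ^ (q + 1), ?_⟩
  have h2 := h1 (m * c)
  have : a ^ k - φ.symm m * (φ.symm m ^ q * φ.symm c ^ (q + 1)) =
      (a ^ k - m * c) + (m * c - φ.symm (m * c) ^ (q + 1)) := by
    rw [map_mul]
    ring
  rw [this]
  exact dvd_add hk h2

end IsUnitModAway

variable {A K Ω : Type*} [CommRing A] [Field K] [Field Ω] [Algebra K Ω] [Algebra A Ω]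

/-- An intermediate field `N` of `Ω/K` that has Galois coordinates after inverting an element of
`A` that becomes a unit in `(A/π)[1/a]`. -/
def IntermediateField.HasGaloisFamily (π a : A) (N : IntermediateField K Ω) : Prop :=
  ∃ (ι : Type) (_ : Fintype ι) (x y : ι → Ω) (m : A),
    (∀ i, x i ∈ N ∧ IsIntegral A (x i)) ∧ (∀ i, y i ∈ N ∧ IsIntegral A (y i)) ∧
    IsUnitModAway π a m ∧
    ∀ σ : Gal(Ω/K), (σ ∈ N.fixingSubgroup → ∑ i, x i * σ (y i) = algebraMap A Ω m) ∧
      (σ ∉ N.fixingSubgroup → ∑ i, x i * σ (y i) = 0)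

namespace IntermediateField.HasGaloisFamily

variable {π a : A}

lemma of_fintype {N : IntermediateField K Ω} {ι : Type*} [Fintype ι] (x y : ι → Ω) (m : A)
    (hx : ∀ i, x i ∈ N ∧ IsIntegral A (x i)) (hy : ∀ i, y i ∈ N ∧ IsIntegral A (y i))
    (hm : IsUnitModAway π a m)
    (h : ∀ σ : Gal(Ω/K), (σ ∈ N.fixingSubgroup → ∑ i, x i * σ (y i) = algebraMap A Ω m) ∧
      (σ ∉ N.fixingSubgroup → ∑ i, x i * σ (y i) = 0)) : N.HasGaloisFamily π a := by
  let e := Fintype.equivFin ι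
  refine ⟨Fin (Fintype.card ι), inferInstance, x ∘ e.symm, y ∘ e.symm, m, fun i ↦ hx _,
    fun i ↦ hy _, hm, fun σ ↦ ?_⟩
  rw [show ∑ i, (x ∘ e.symm) i * σ ((y ∘ e.symm) i) = ∑ i, x i * σ (y i) from
    e.symm.sum_comp fun i ↦ x i * σ (y i)]
  exact h σ

lemma bot : (⊥ : IntermediateField K Ω).HasGaloisFamily π a :=
  of_fintype (fun _ : Unit ↦ 1) (fun _ ↦ 1) 1 (fun _ ↦ ⟨one_mem _, isIntegral_one⟩)
    (fun _ ↦ ⟨one_mem _, isIntegral_one⟩) .one fun σ ↦ by simp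

/-- For the products of the two families the sum factors, and an automorphism fixes the compositum
exactly when it fixes both fields. -/
lemma sup {N N' : IntermediateField K Ω} (h : N.HasGaloisFamily π a)
    (h' : N'.HasGaloisFamily π a) : (N ⊔ N').HasGaloisFamily π a := by
  obtain ⟨ι, _, x, y, m, hx, hy, hm, hs⟩ := h
  obtain ⟨ι', _, x', y', m', hx', hy', hm', hs'⟩ := h'
  have hle : N ≤ N ⊔ N' := le_sup_left
  have hle' : N' ≤ N ⊔ N' := le_sup_right
  refine of_fintype (fun i : ι × ι' ↦ x i.1 * x' i.2) (fun i ↦ y i.1 * y' i.2) (m * m')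
    (fun i ↦ ⟨mul_mem (hle (hx _).1) (hle' (hx' _).1), (hx _).2.mul (hx' _).2⟩)
    (fun i ↦ ⟨mul_mem (hle (hy _).1) (hle' (hy' _).1), (hy _).2.mul (hy' _).2⟩)
    (hm.mul hm') fun σ ↦ ?_
  have key : ∑ i : ι × ι', x i.1 * x' i.2 * σ (y i.1 * y' i.2) =
      (∑ i, x i * σ (y i)) * ∑ i, x' i * σ (y' i) := by
    rw [Fintype.sum_mul_sum, Fintype.sum_prod_type]
    refine Finset.sum_congr rfl fun i _ ↦ Finset.sum_congr rfl fun j _ ↦ ?_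
    rw [map_mul]
    ring
  rw [key, fixingSubgroup_sup, Subgroup.mem_inf, map_mul]
  constructor
  · rintro ⟨h1, h2⟩
    rw [(hs σ).1 h1, (hs' σ).1 h2]
  · intro h
    rw [not_and_or] at h
    rcases h with h | h
    · rw [(hs σ).2 h, zero_mul]
    · rw [(hs' σ).2 h, mul_zero]

lemma finset_sup {κ : Type*} (s : Finset κ) (N : κ → IntermediateField K Ω)
    (h : ∀ i, (N i).HasGaloisFamily π a) : (s.sup N).HasGaloisFamily π a :=
  Finset.sup_induction bot (fun _ h _ h' ↦ sup h h') fun i _ ↦ h i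

end IntermediateField.HasGaloisFamily

/-- A ring automorphism of `Ω` that is compatible with an automorphism of `A` maps the fraction
field `K` of `A` to itself. -/
lemma map_algebraMap_mem_range [IsDomain A] [Algebra A K] [IsFractionRing A K] [IsScalarTower A K Ω]
    {φ : A ≃+* A} {Φ : Ω ≃+* Ω} (hΦ : ∀ r, Φ (algebraMap A Ω r) = algebraMap A Ω (φ r)) (k : K) :
    ∃ k', Φ (algebraMap K Ω k) = algebraMap K Ω k' := by
  obtain ⟨u, v, -, rfl⟩ := IsFractionRing.div_surjective A k
  refine ⟨algebraMap A K (φ u) / algebraMap A K (φ v), ?_⟩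
  simp only [map_div₀, ← IsScalarTower.algebraMap_apply, hΦ]

lemma IsIntegral.map_semilinear {φ : A ≃+* A} {Φ : Ω ≃+* Ω}
    (hΦ : ∀ r, Φ (algebraMap A Ω r) = algebraMap A Ω (φ r)) {z : Ω} (hz : IsIntegral A z) :
    IsIntegral A (Φ z) := by
  obtain ⟨P, hP, h⟩ := hz
  refine ⟨P.map φ.toRingHom, hP.map _, ?_⟩
  have h1 := congrArg Φ.toRingHom h
  rw [Polynomial.hom_eval₂, map_zero] at h1
  rw [Polynomial.eval₂_map, ← h1]
  congr 1
  ext r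
  exact (hΦ r).symm

lemma RingEquiv.symm_semilinear {φ : A ≃+* A} {Φ : Ω ≃+* Ω}
    (hΦ : ∀ r, Φ (algebraMap A Ω r) = algebraMap A Ω (φ r)) (r : A) :
    Φ.symm (algebraMap A Ω r) = algebraMap A Ω (φ.symm r) := by
  rw [RingEquiv.symm_apply_eq, hΦ, RingEquiv.apply_symm_apply]

section Semilinear

variable [IsDomain A] [Algebra A K] [IsFractionRing A K] [IsScalarTower A K Ω]
  {φ : A ≃+* A} {Φ : Ω ≃+* Ω} (hΦ : ∀ r, Φ (algebraMap A Ω r) = algebraMap A Ω (φ r))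

/-- The image of an intermediate field under a ring automorphism that preserves `A`. -/
def IntermediateField.semilinearMap (N : IntermediateField K Ω) : IntermediateField K Ω where
  toSubalgebra :=
    { N.toSubfield.map Φ.toRingHom with
      algebraMap_mem' := fun k ↦ by
        obtain ⟨k', hk'⟩ := map_algebraMap_mem_range (RingEquiv.symm_semilinear hΦ) k
        exact ⟨algebraMap K Ω k', N.algebraMap_mem k', by
          rw [← hk']
          exact Φ.apply_symm_apply _⟩ }
  inv_mem' := (N.toSubfield.map Φ.toRingHom).inv_mem'

lemma IntermediateField.mem_semilinearMap {N : IntermediateField K Ω} {z : Ω} :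
    z ∈ N.semilinearMap hΦ ↔ Φ.symm z ∈ N := by
  constructor
  · rintro ⟨y, hy, rfl⟩
    exact (Φ.symm_apply_apply y).symm ▸ hy
  · intro h
    exact ⟨_, h, Φ.apply_symm_apply z⟩

/-- Conjugation of a `K`-automorphism by a ring automorphism that preserves `A`. -/
def AlgEquiv.semilinearConj (σ : Gal(Ω/K)) : Gal(Ω/K) :=
  AlgEquiv.ofRingEquiv (f := (Φ.trans σ.toRingEquiv).trans Φ.symm) fun k ↦ by
    obtain ⟨k', hk'⟩ := map_algebraMap_mem_range hΦ k
    change Φ.symm (σ (Φ _)) = _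
    rw [hk', AlgEquiv.commutes, ← hk', Φ.symm_apply_apply]

lemma AlgEquiv.semilinearConj_apply (σ : Gal(Ω/K)) (z : Ω) :
    σ.semilinearConj hΦ z = Φ.symm (σ (Φ z)) := rfl

lemma IntermediateField.semilinearConj_mem_fixingSubgroup {N : IntermediateField K Ω}
    {σ : Gal(Ω/K)} :
    σ.semilinearConj hΦ ∈ N.fixingSubgroup ↔ σ ∈ (N.semilinearMap hΦ).fixingSubgroup := by
  rw [mem_fixingSubgroup_iff, mem_fixingSubgroup_iff]
  constructor
  · intro h z hz
    have := h _ ((mem_semilinearMap hΦ).mp hz)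
    rw [AlgEquiv.semilinearConj_apply, Φ.apply_symm_apply] at this
    exact Φ.symm.injective this
  · intro h z hz
    rw [AlgEquiv.semilinearConj_apply, h (Φ z) ⟨z, hz, rfl⟩, Φ.symm_apply_apply]

/-- Apply Φ to the family: the relation for σ on the image is Φ of the relation for Φ⁻¹ σ Φ on N. -/
lemma IntermediateField.HasGaloisFamily.semilinearMap {π a : A} {N : IntermediateField K Ω}
    (h : N.HasGaloisFamily π a) (hφ : ∀ m, IsUnitModAway π a m → IsUnitModAway π a (φ m)) :
    (N.semilinearMap hΦ).HasGaloisFamily π a := by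
  obtain ⟨ι, _, x, y, m, hx, hy, hm, hs⟩ := h
  refine of_fintype (Φ ∘ x) (Φ ∘ y) (φ m) (fun i ↦ ⟨⟨_, (hx i).1, rfl⟩, (hx i).2.map_semilinear hΦ⟩)
    (fun i ↦ ⟨⟨_, (hy i).1, rfl⟩, (hy i).2.map_semilinear hΦ⟩) (hφ m hm) fun σ ↦ ?_
  have key : ∑ i, (Φ ∘ x) i * σ ((Φ ∘ y) i) = Φ (∑ i, x i * σ.semilinearConj hΦ (y i)) := by
    rw [map_sum]
    refine Finset.sum_congr rfl fun i _ ↦ ?_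
    rw [map_mul, AlgEquiv.semilinearConj_apply, Φ.apply_symm_apply]
    rfl
  rw [key, ← semilinearConj_mem_fixingSubgroup hΦ]
  constructor
  · intro h
    rw [(hs _).1 h, hΦ]
  · intro h
    rw [(hs _).2 h, map_zero]

end Semilinear

section Union

/-- The union of the intermediate fields with a Galois family. -/
def galoisFamilyUnion (K Ω : Type*) [Field K] [Field Ω] [Algebra K Ω] [Algebra A Ω]
    (π a : A) : IntermediateField K Ω where
  carrier := { z | ∃ N : IntermediateField K Ω, N.HasGaloisFamily π a ∧ z ∈ N }
  mul_mem' := by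
    rintro z z' ⟨N, hN, hz⟩ ⟨N', hN', hz'⟩
    exact ⟨N ⊔ N', hN.sup hN', mul_mem ((le_sup_left : N ≤ _) hz) ((le_sup_right : N' ≤ _) hz')⟩
  add_mem' := by
    rintro z z' ⟨N, hN, hz⟩ ⟨N', hN', hz'⟩
    exact ⟨N ⊔ N', hN.sup hN', add_mem ((le_sup_left : N ≤ _) hz) ((le_sup_right : N' ≤ _) hz')⟩
  algebraMap_mem' k := ⟨⊥, .bot, algebraMap_mem _ k⟩
  inv_mem' := by
    rintro z ⟨N, hN, hz⟩
    exact ⟨N, hN, inv_mem hz⟩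

variable [Algebra A K] [IsScalarTower A K Ω]

lemma galEquiv_algebraMap (σ : Gal(Ω/K)) (r : A) :
    σ.toRingEquiv (algebraMap A Ω r) = algebraMap A Ω (RingEquiv.refl A r) := by
  change σ (algebraMap A Ω r) = algebraMap A Ω r
  rw [IsScalarTower.algebraMap_apply A K Ω]
  exact σ.commutes _

variable [IsDomain A] [IsFractionRing A K]

lemma map_mem_galoisFamilyUnion {π a : A} {φ : A ≃+* A} {Φ : Ω ≃+* Ω}
    (hΦ : ∀ r, Φ (algebraMap A Ω r) = algebraMap A Ω (φ r))
    (hφ : ∀ m, IsUnitModAway π a m → IsUnitModAway π a (φ m)) {z : Ω}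
    (hz : z ∈ galoisFamilyUnion K Ω π a) : Φ z ∈ galoisFamilyUnion K Ω π a := by
  obtain ⟨N, hN, hz⟩ := hz
  exact ⟨N.semilinearMap hΦ, hN.semilinearMap hΦ hφ, ⟨z, hz, rfl⟩⟩

variable [IsGalois K Ω]

/-- If σ fixes all y_i, its sum is that of the identity, namely m ≠ 0, so σ fixes N. By Galois
theory N lies in K(y_1, y_2, …). -/
lemma IntermediateField.HasGaloisFamily.finiteDimensional {π a : A} (hπ : Prime π)
    (ha : ¬ π ∣ a) {N : IntermediateField K Ω} (h : N.HasGaloisFamily π a) :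
    FiniteDimensional K N := by
  obtain ⟨ι, _, x, y, m, hx, hy, hm, hs⟩ := h
  let N' : IntermediateField K Ω := adjoin K (Set.range y)
  have hN' : FiniteDimensional K N' := finiteDimensional_adjoin fun z _ ↦
    Algebra.IsIntegral.isIntegral z
  have hm0 : algebraMap A Ω m ≠ 0 := by
    rw [IsScalarTower.algebraMap_apply A K Ω]
    exact (map_ne_zero _).mpr
      ((map_ne_zero_iff _ (FaithfulSMul.algebraMap_injective A K)).mpr (hm.ne_zero hπ ha))
  have hle : N'.fixingSubgroup ≤ N.fixingSubgroup := by
    intro σ hσ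
    by_contra h
    have h1 := (hs σ).2 h
    have h2 := (hs 1).1 (one_mem _)
    rw [mem_fixingSubgroup_iff] at hσ
    have h3 : ∑ i, x i * σ (y i) = ∑ i, x i * (1 : Gal(Ω/K)) (y i) :=
      Finset.sum_congr rfl fun i _ ↦ by
        rw [hσ (y i) (subset_adjoin K _ ⟨i, rfl⟩)]
        rfl
    rw [← h2, ← h3, h1] at hm0
    exact hm0 rfl
  have : N ≤ N' := by
    rw [← InfiniteGalois.fixedField_fixingSubgroup N, ← InfiniteGalois.fixedField_fixingSubgroup N']
    exact fixedField_antitone hle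
  exact .of_injective (inclusion this).toLinearMap (inclusion_injective this)

/-- The normal closure is the compositum of the finitely many conjugates σ(N), and each of them
carries the transported family. -/
lemma IntermediateField.HasGaloisFamily.normalClosure {π a : A} (hπ : Prime π)
    (ha : ¬ π ∣ a) {N : IntermediateField K Ω} (h : N.HasGaloisFamily π a) :
    (IntermediateField.normalClosure K N Ω).HasGaloisFamily π a := by
  have := h.finiteDimensional hπ ha
  rw [normalClosure_def, ← Finset.sup_univ_eq_iSup]
  refine finset_sup _ _ fun f ↦ ?_
  let σ : Gal(Ω/K) := AlgEquiv.ofBijective (f.liftNormal Ω)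
    (Algebra.IsAlgebraic.algHom_bijective _)
  have hσ : ∀ z : N, σ z = f z := fun z ↦ f.liftNormal_commutes Ω z
  have : f.fieldRange = N.semilinearMap (galEquiv_algebraMap (A := A) σ) := by
    ext z
    constructor
    · rintro ⟨y, rfl⟩
      exact ⟨y, y.2, hσ y⟩
    · rintro ⟨y, hy, rfl⟩
      exact ⟨⟨y, hy⟩, (hσ ⟨y, hy⟩).symm⟩
  rw [this]
  exact h.semilinearMap _ fun _ h ↦ h

end Union

end GaloisFamily

/-! ### From Galois families to Galois coordinates. -/

section GaloisCoordinatesOfFamily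

variable {A K Ω : Type*} [CommRing A] [IsIntegrallyClosed A] [Field K] [Algebra A K]
  [IsFractionRing A K] [Field Ω] [Algebra K Ω] [Algebra A Ω] [IsScalarTower A K Ω] [Normal K Ω]

/-- The ring of integral elements of a finite Galois intermediate field with a Galois family has
Galois coordinates. -/
lemma IntermediateField.HasGaloisFamily.exists_galoisCoordinates {π a : A}
    {N : IntermediateField K Ω} [FiniteDimensional K N] [IsGalois K N]
    (h : N.HasGaloisFamily π a) :
    ∃ (ι : Type) (_ : Fintype ι) (D : GaloisCoordinates A (integralClosure A N) Gal(N/K) ι),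
      IsUnitModAway π a D.m := by
  obtain ⟨ι, _, x, y, m, hx, hy, hm, hs⟩ := h
  have hint : ∀ z : N, IsIntegral A (z : Ω) → IsIntegral A z := fun z hz ↦
    (isIntegral_algHom_iff (N.val.restrictScalars A) N.val.injective).mp hz
  let X : ι → integralClosure A N := fun i ↦ ⟨⟨x i, (hx i).1⟩, hint _ (hx i).2⟩
  let Y : ι → integralClosure A N := fun i ↦ ⟨⟨y i, (hy i).1⟩, hint _ (hy i).2⟩
  have hcoe : ∀ τ : Gal(N/K), ∀ z : integralClosure A N,
      ((galRestrict A K N (integralClosure A N) τ z : N) : Ω) = τ.liftNormal Ω ((z : N) : Ω) := by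
    intro τ z
    rw [show ((galRestrict A K N (integralClosure A N) τ z : N)) = τ (z : N) from
      algebraMap_galRestrict_apply A τ z]
    exact (τ.liftNormal_commutes Ω (z : N)).symm
  have hsum : ∀ τ : Gal(N/K), ((∑ i, X i * galRestrict A K N (integralClosure A N) τ (Y i) :
      integralClosure A N) : Ω) = ∑ i, x i * τ.liftNormal Ω (y i) := by
    intro τ
    rw [AddSubmonoidClass.coe_finsetSum, AddSubmonoidClass.coe_finsetSum]
    refine Finset.sum_congr rfl fun i _ ↦ ?_
    exact congrArg (x i * ·) (hcoe τ (Y i))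
  have hinj : ∀ z w : integralClosure A N, ((z : N) : Ω) = w → z = w := fun z w h ↦
    Subtype.ext (Subtype.ext h)
  refine ⟨ι, inferInstance,
    { act := fun τ ↦ (galRestrict A K N (integralClosure A N) τ : _ →ₐ[A] _)
      one := 1
      act_one := by rw [map_one]; rfl
      tr := Algebra.intTraceAux A K N (integralClosure A N)
      algebraMap_tr := fun b ↦ ?_
      x := X
      y := Y
      m := m
      sum_one := ?_
      sum_ne_one := fun τ hτ ↦ ?_ }, hm⟩
  · apply Subtype.ext
    change algebraMap A N _ = _
    rw [IsScalarTower.algebraMap_apply A K N, Algebra.map_intTraceAux, trace_eq_sum_automorphisms,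
      AddSubmonoidClass.coe_finsetSum]
    exact Finset.sum_congr rfl fun τ _ ↦ (algebraMap_galRestrict_apply A τ b).symm
  · have h1 := (hs 1).1 (one_mem _)
    apply hinj
    rw [AddSubmonoidClass.coe_finsetSum, AddSubmonoidClass.coe_finsetSum]
    exact h1
  · apply hinj
    change ((∑ i, X i * galRestrict A K N (integralClosure A N) τ (Y i) :
      integralClosure A N) : Ω) = _
    rw [hsum]
    -- The relations are indexed by Gal(Ω/K). An extension of τ to Ω fixes N only if τ is the
    -- identity.
    refine (hs _).2 fun h ↦ hτ ?_
    ext z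
    rw [mem_fixingSubgroup_iff] at h
    exact (τ.liftNormal_commutes Ω z).symm.trans (h z z.2)

end GaloisCoordinatesOfFamily

/-! ### Homomorphisms that agree on the invariants of a profinite action. -/

section InvariantHoms

open Polynomial

variable {G T D : Type*} [Group G] [CommRing T] [MulSemiringAction G T] [CommRing D] [IsDomain D]

/-- The product of X - w over the orbit of t has invariant coefficients, so f and g send it to the
same polynomial. Its root g(t) must be one of the f(w). -/
lemma exists_apply_smul_eq_of_finite_orbit {f g : T →+* D}
    (h : ∀ t, (∀ σ : G, σ • t = t) → f t = g t) {t : T} (ht : (MulAction.orbit G t).Finite) :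
    ∃ σ : G, g t = f (σ • t) := by
  let P : T[X] := ∏ w ∈ ht.toFinset, (X - C w)
  have hP : P.map f = P.map g := by
    ext i
    rw [coeff_map, coeff_map]
    refine h _ fun σ ↦ ?_
    rw [← coeff_smul]
    congr 1
    change σ • ∏ w ∈ ht.toFinset, (X - C w) = _
    rw [Finset.smul_prod']
    refine Finset.prod_nbij' (σ • ·) (σ⁻¹ • ·) ?_ ?_ ?_ ?_ ?_
    · intro w hw
      rw [Set.Finite.mem_toFinset] at hw ⊢
      exact MulAction.mem_orbit_of_mem_orbit _ hw
    · intro w hw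
      rw [Set.Finite.mem_toFinset] at hw ⊢
      exact MulAction.mem_orbit_of_mem_orbit _ hw
    · intro w _
      exact inv_smul_smul σ w
    · intro w _
      exact smul_inv_smul σ w
    · intro w _
      rw [smul_sub, smul_C, smul_X]
  have h0 : (P.map g).eval (g t) = 0 := by
    have : P.eval t = 0 := by
      rw [eval_prod]
      exact Finset.prod_eq_zero (i := t)
        (ht.mem_toFinset.mpr (MulAction.mem_orbit_self t)) (by simp)
    rw [Polynomial.eval_map, eval₂_at_apply, this, map_zero]
  rw [← hP, Polynomial.map_prod, eval_prod, Finset.prod_eq_zero_iff] at h0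
  obtain ⟨w, hw, h1⟩ := h0
  obtain ⟨σ, rfl⟩ := ht.mem_toFinset.mp hw
  refine ⟨σ, ?_⟩
  rw [Polynomial.map_sub, map_X, map_C, eval_sub, eval_X, eval_C, sub_eq_zero] at h1
  exact h1

/-- Finitely many elements become the coefficients of one polynomial, and the case of one element is
applied to T[X] → D[X]. -/
lemma exists_forall_apply_smul_eq_of_finite_orbit {f g : T →+* D}
    (h : ∀ t, (∀ σ : G, σ • t = t) → f t = g t) (hfin : ∀ t : T, (MulAction.orbit G t).Finite)
    (s : Finset T) : ∃ σ : G, ∀ t ∈ s, g t = f (σ • t) := by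
  let e := s.equivFin
  let θ : (s → T) → T[X] := fun z ↦ ∑ i, C (z i) * X ^ (e i : ℕ)
  have hcoeff : ∀ z i, (θ z).coeff (e i) = z i := by
    intro z i
    rw [finsetSum_coeff, Finset.sum_eq_single i]
    · simp
    · intro j _ hj
      rw [coeff_C_mul, coeff_X_pow, if_neg, mul_zero]
      intro h
      exact hj (e.injective (Fin.ext h.symm))
    · intro h
      exact absurd (Finset.mem_univ i) h
  have hsmul : ∀ (σ : G) z, σ • θ z = θ (fun i ↦ σ • z i) := by
    intro σ z
    change σ • (∑ i, C (z i) * X ^ (e i : ℕ)) = _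
    rw [Finset.smul_sum]
    refine Finset.sum_congr rfl fun i _ ↦ ?_
    rw [smul_mul', smul_C, smul_pow', smul_X]
  have horb : (MulAction.orbit G (θ fun i ↦ (i : T))).Finite := by
    refine ((Set.Finite.pi' fun i : s ↦ hfin (i : T)).image θ).subset ?_
    rintro _ ⟨σ, rfl⟩
    exact ⟨_, fun i ↦ ⟨σ, rfl⟩, (hsmul σ _).symm⟩
  obtain ⟨σ, hσ⟩ := exists_apply_smul_eq_of_finite_orbit (f := mapRingHom f) (g := mapRingHom g)
    (fun t ht ↦ ext fun i ↦ by
      rw [coe_mapRingHom, coe_mapRingHom, coeff_map, coeff_map]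
      exact h _ fun σ ↦ by rw [← coeff_smul, ht σ]) horb
  refine ⟨σ, fun t ht ↦ ?_⟩
  have h1 := congrArg (fun P ↦ P.coeff (e ⟨t, ht⟩)) hσ
  simp only [hsmul, coe_mapRingHom, coeff_map, hcoeff] at h1
  exact h1

/-- Let a compact group act on a ring with open stabilizers. Two homomorphisms to a domain that
agree on the invariants differ by an element of the group. -/
theorem exists_forall_apply_smul_eq [TopologicalSpace G] [IsTopologicalGroup G] [CompactSpace G]
    (hopen : ∀ t : T, IsOpen (MulAction.stabilizer G t : Set G)) {f g : T →+* D}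
    (h : ∀ t, (∀ σ : G, σ • t = t) → f t = g t) : ∃ σ : G, ∀ t, g t = f (σ • t) := by
  have hlc : ∀ t : T, IsLocallyConstant fun σ : G ↦ σ • t := by
    intro t
    rw [IsLocallyConstant.iff_exists_open]
    intro σ
    refine ⟨(fun τ ↦ σ⁻¹ * τ) ⁻¹' MulAction.stabilizer G t,
      (hopen t).preimage (continuous_const_mul σ⁻¹), ?_, fun τ hτ ↦ ?_⟩
    · rw [Set.mem_preimage, inv_mul_cancel]
      exact one_mem _
    · have h1 : (σ⁻¹ * τ) • t = t := hτ
      rw [mul_smul, inv_smul_eq_iff] at h1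
      exact h1
  have hclosed : ∀ t, IsClosed {σ : G | g t = f (σ • t)} := fun t ↦
    ⟨(hlc t) {w | g t = f w}ᶜ⟩
  -- Each t imposes a closed condition on σ, and any finitely many of them can be met together.
  have := isCompact_univ.inter_iInter_nonempty (fun t ↦ {σ : G | g t = f (σ • t)}) hclosed
    fun s ↦ by
      obtain ⟨σ, hσ⟩ := exists_forall_apply_smul_eq_of_finite_orbit h
        (fun t ↦ (hlc t).range_finite) s
      exact ⟨σ, Set.mem_univ _, Set.mem_iInter₂.mpr hσ⟩
  obtain ⟨σ, -, hσ⟩ := this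
  exact ⟨σ, Set.mem_iInter.mp hσ⟩

end InvariantHoms

/-! ### Extensions étale away from a have Galois families. -/

section UnramifiedAway

open TensorProduct

/-- If `S` is étale over `R` after inverting `a`, then the idempotent of the diagonal times a power
of `a` comes from `S ⊗[R] S`; here its values at pairs of points of `S` are given. -/
lemma exists_sum_mul_eq_of_etale_away {R S : Type*} [CommRing R] [CommRing S] [Algebra R S] (a : R)
    (h : (Localization.awayMap (algebraMap R S) a).Etale) (Ω : Type*) [Field Ω] :
    ∃ (n : ℕ) (x y : Fin n → S) (k : ℕ), ∀ f g : S →+* Ω,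
      f.comp (algebraMap R S) = g.comp (algebraMap R S) → f (algebraMap R S a) ≠ 0 →
      (f = g → ∑ i, f (x i) * g (y i) = f (algebraMap R S a) ^ k) ∧
        (f ≠ g → ∑ i, f (x i) * g (y i) = 0) := by
  let R' := Localization.Away a
  let S' := Localization.Away (algebraMap R S a)
  let : Algebra R' S' := (Localization.awayMap (algebraMap R S) a).toAlgebra
  have : Algebra.Etale R' S' := h
  obtain ⟨t, ht, ht1⟩ := Algebra.FormallyUnramified.iff_exists_tensorProduct.mp
    (inferInstance : Algebra.FormallyUnramified R' S')
  obtain ⟨s, rfl⟩ := TensorProduct.exists_finset t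
  obtain ⟨⟨_, k, rfl⟩, hk⟩ := IsLocalization.exist_integer_multiples
    (Submonoid.powers (algebraMap R S a)) s Prod.fst
  obtain ⟨⟨_, l, rfl⟩, hl⟩ := IsLocalization.exist_integer_multiples
    (Submonoid.powers (algebraMap R S a)) s Prod.snd
  let e := s.equivFin
  choose x hx using fun i : s ↦ hk i i.2
  choose y hy using fun i : s ↦ hl i i.2
  -- a^k clears the denominators of the first tensor factors and a^l those of the second.
  refine ⟨s.card, x ∘ e.symm, y ∘ e.symm, k + l, fun f g hfg hfa ↦ ?_⟩
  have hga : g (algebraMap R S a) = f (algebraMap R S a) := (RingHom.congr_fun hfg a).symm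
  let f' : S' →+* Ω := IsLocalization.Away.lift (algebraMap R S a) hfa.isUnit
  let g' : S' →+* Ω := IsLocalization.Away.lift (algebraMap R S a) (hga ▸ hfa).isUnit
  have hf' : ∀ z, f' (algebraMap S S' z) = f z := IsLocalization.Away.lift_eq _ _
  have hg' : ∀ z, g' (algebraMap S S' z) = g z := IsLocalization.Away.lift_eq _ _
  have hR' : ∀ r : R, algebraMap R' S' (algebraMap R R' r) = algebraMap S S' (algebraMap R S r) :=
    fun r ↦ IsLocalization.Away.lift_eq (S := R') a (g := (algebraMap S S').comp (algebraMap R S))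
      (IsLocalization.Away.algebraMap_isUnit (algebraMap R S a)) r
  have hfg' : f'.comp (algebraMap R' S') = g'.comp (algebraMap R' S') := by
    refine IsLocalization.ringHom_ext (Submonoid.powers a) (RingHom.ext fun r ↦ ?_)
    simp only [RingHom.comp_apply, hR', hf', hg']
    exact RingHom.congr_fun hfg r
  let : Algebra R' Ω := (f'.comp (algebraMap R' S')).toAlgebra
  let F : S' →ₐ[R'] Ω := { f' with commutes' := fun _ ↦ rfl }
  let G : S' →ₐ[R'] Ω := { g' with commutes' := fun r ↦ (RingHom.congr_fun hfg' r).symm }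
  let FG := Algebra.TensorProduct.lift F G fun _ _ ↦ Commute.all _ _
  have hFG : ∀ u v, FG (u ⊗ₜ v) = f' u * g' v := fun u v ↦
    Algebra.TensorProduct.lift_tmul F G _ u v
  have hsum : ∑ i, f ((x ∘ e.symm) i) * g ((y ∘ e.symm) i) =
      f (algebraMap R S a) ^ (k + l) * ∑ z ∈ s, f' z.1 * g' z.2 := by
    rw [Finset.mul_sum, ← Finset.sum_coe_sort s, ← e.symm.sum_comp]
    refine Finset.sum_congr rfl fun i _ ↦ ?_
    have h1 := congrArg f' (hx (e.symm i))
    have h2 := congrArg g' (hy (e.symm i))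
    rw [hf', Algebra.smul_def, map_mul, hf', map_pow] at h1
    rw [hg', Algebra.smul_def, map_mul, hg', map_pow, hga] at h2
    rw [Function.comp_apply, Function.comp_apply, h1, h2]
    ring
  have hval : FG (∑ z ∈ s, z.1 ⊗ₜ z.2) = ∑ z ∈ s, f' z.1 * g' z.2 := by
    rw [map_sum]
    exact Finset.sum_congr rfl fun z _ ↦ hFG _ _
  constructor
  · rintro rfl
    have h1 := congrArg f' ht1
    rw [map_sum, map_sum, map_one] at h1
    simp only [Algebra.TensorProduct.lmul'_apply_tmul, map_mul] at h1
    rw [hsum, show ∑ z ∈ s, f' z.1 * g' z.2 = 1 from h1, mul_one]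
  · intro hne
    obtain ⟨z, hz⟩ := DFunLike.ne_iff.mp hne
    -- Evaluating (1 ⊗ z - z ⊗ 1) t = 0 at the pair (f, g) gives (g z - f z) FG(t) = 0 with f z ≠ g
    -- z.
    have h1 := congrArg FG (ht (algebraMap S S' z))
    rw [map_mul, map_sub, hFG, hFG, hf', hg', map_one, map_one, one_mul, mul_one, map_zero,
      hval, mul_eq_zero, sub_eq_zero] at h1
    rw [hsum, h1.resolve_left (Ne.symm hz), mul_zero]

/-- An extension that is étale after inverting `a` is contained in the union of the intermediate
fields with a Galois family. -/
lemma algebraMap_mem_galoisFamilyUnion {R S A K Ω : Type*} [CommRing R] [CommRing S] [Algebra R S]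
    [Algebra.IsIntegral R S] [CommRing A] [Algebra R A] [Field K] [Algebra A K] [Field Ω]
    [Algebra K Ω] [Algebra A Ω] [IsScalarTower A K Ω] [Algebra S Ω] [Algebra R Ω]
    [IsScalarTower R S Ω] [IsScalarTower R A Ω] {a : R} (ha : algebraMap R Ω a ≠ 0)
    (h : (Localization.awayMap (algebraMap R S) a).Etale) (π : A) (s : S) :
    algebraMap S Ω s ∈ galoisFamilyUnion K Ω π (algebraMap R A a) := by
  obtain ⟨n, x, y, k, hxy⟩ := exists_sum_mul_eq_of_etale_away a h Ω
  let N : IntermediateField K Ω := .adjoin K (Set.range (algebraMap S Ω))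
  have hmem : ∀ s, algebraMap S Ω s ∈ N := fun s ↦ IntermediateField.subset_adjoin K _ ⟨s, rfl⟩
  have hint : ∀ s, IsIntegral A (algebraMap S Ω s) := fun s ↦
    ((Algebra.IsIntegral.isIntegral (R := R) s).map (IsScalarTower.toAlgHom R S Ω)).tower_top
  refine ⟨N, .of_fintype (fun i ↦ algebraMap S Ω (x i)) (fun i ↦ algebraMap S Ω (y i))
    (algebraMap R A a ^ k) (fun i ↦ ⟨hmem _, hint _⟩) (fun i ↦ ⟨hmem _, hint _⟩) (.pow_self k)
    fun σ ↦ ?_, hmem s⟩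
  let g : S →+* Ω := (σ : Ω →+* Ω).comp (algebraMap S Ω)
  have hg : (algebraMap S Ω).comp (algebraMap R S) = g.comp (algebraMap R S) := by
    ext r
    change algebraMap S Ω (algebraMap R S r) = σ (algebraMap S Ω (algebraMap R S r))
    rw [← IsScalarTower.algebraMap_apply, IsScalarTower.algebraMap_apply R A Ω,
      IsScalarTower.algebraMap_apply A K Ω, AlgEquiv.commutes]
  -- The pair of points is S → Ω and its composite with σ. They coincide exactly when σ fixes N,
  -- which is generated by S.
  have := hxy (algebraMap S Ω) g hg (by rwa [← IsScalarTower.algebraMap_apply])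
  constructor
  · intro hσ
    rw [IntermediateField.mem_fixingSubgroup_iff] at hσ
    rw [map_pow, ← IsScalarTower.algebraMap_apply, IsScalarTower.algebraMap_apply R S Ω]
    exact this.1 (RingHom.ext fun s ↦ (hσ _ (hmem s)).symm)
  · refine fun hσ ↦ this.2 fun hgeq ↦ hσ ?_
    rw [IntermediateField.mem_fixingSubgroup_iff]
    refine (IntermediateField.forall_mem_adjoin_smul_eq_self_iff K σ).mpr ?_
    rintro _ ⟨s, rfl⟩
    exact (RingHom.congr_fun hgeq s).symm

end UnramifiedAway

/-! ### The integral closure T of A in L: normality and divisibility by π. -/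

/-- A ring homomorphism to `Ω` with values in a subring `T` as a ring homomorphism to `T`. -/
noncomputable def RingHom.descend {B T Ω : Type*} [CommRing B] [CommRing T] [CommRing Ω]
    [Algebra T Ω] [FaithfulSMul T Ω] (f : B →+* Ω) (hf : ∀ b, ∃ t, algebraMap T Ω t = f b) :
    B →+* T where
  toFun b := (hf b).choose
  map_one' := FaithfulSMul.algebraMap_injective T Ω (by
    rw [(hf 1).choose_spec, map_one, map_one])
  map_mul' b c := FaithfulSMul.algebraMap_injective T Ω (by
    rw [(hf _).choose_spec, map_mul, map_mul, (hf b).choose_spec, (hf c).choose_spec])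
  map_zero' := FaithfulSMul.algebraMap_injective T Ω (by
    rw [(hf 0).choose_spec, map_zero, map_zero])
  map_add' b c := FaithfulSMul.algebraMap_injective T Ω (by
    rw [(hf _).choose_spec, map_add, map_add, (hf b).choose_spec, (hf c).choose_spec])

lemma RingHom.algebraMap_descend {B T Ω : Type*} [CommRing B] [CommRing T] [CommRing Ω]
    [Algebra T Ω] [FaithfulSMul T Ω] (f : B →+* Ω) (hf : ∀ b, ∃ t, algebraMap T Ω t = f b) (b : B) :
    algebraMap T Ω (f.descend hf b) = f b := (hf b).choose_spec

/-- `T` is the ring of elements of `L` that are integral over `A`. -/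
def IsIntegralClosureIn (A T : Type*) {K Ω : Type*} [CommRing A] [CommRing T] [Field K] [Field Ω]
    [Algebra K Ω] [Algebra A Ω] [Algebra T Ω] (L : IntermediateField K Ω) : Prop :=
  ∀ z : Ω, (∃ t : T, algebraMap T Ω t = z) ↔ IsIntegral A z ∧ z ∈ L

namespace IsIntegralClosureIn

section General

variable {A T K Ω : Type*} [CommRing A] [CommRing T] [Field K] [Field Ω] [Algebra K Ω]
  [Algebra A Ω] [Algebra T Ω] {L : IntermediateField K Ω} (hT : IsIntegralClosureIn A T L)

include hT

lemma isIntegral_algebraMap (t : T) : IsIntegral A (algebraMap T Ω t) := ((hT _).mp ⟨t, rfl⟩).1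

lemma algebraMap_mem (t : T) : algebraMap T Ω t ∈ L := ((hT _).mp ⟨t, rfl⟩).2

variable [Algebra A T] [IsScalarTower A T Ω] [FaithfulSMul T Ω]

lemma isIntegral : Algebra.IsIntegral A T := ⟨fun t ↦
  (isIntegral_algHom_iff (IsScalarTower.toAlgHom A T Ω)
    (FaithfulSMul.algebraMap_injective T Ω)).mp (hT.isIntegral_algebraMap t)⟩

lemma isIntegrallyClosed [IsDomain T] : IsIntegrallyClosed T := by
  have := hT.isIntegral
  refine (isIntegrallyClosed_iff (FractionRing T)).mpr fun {z} hz ↦ ?_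
  let f : FractionRing T →ₐ[T] Ω := IsFractionRing.liftAlgHom (g := Algebra.ofId T Ω)
    (FaithfulSMul.algebraMap_injective T Ω)
  have hf : f z ∈ L := by
    obtain ⟨u, v, -, rfl⟩ := IsFractionRing.div_surjective T z
    rw [map_div₀, AlgHom.commutes, AlgHom.commutes]
    exact div_mem (hT.algebraMap_mem u) (hT.algebraMap_mem v)
  obtain ⟨t, ht⟩ := (hT (f z)).mpr ⟨isIntegral_trans (A := T) _ (hz.map f), hf⟩
  refine ⟨t, f.injective ?_⟩
  change f (algebraMap T (FractionRing T) t) = f z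
  rw [AlgHom.commutes, ht]

lemma dvd_iff {π : A} {t : T} :
    algebraMap A T π ∣ t ↔ ∃ z ∈ L, IsIntegral A z ∧ algebraMap T Ω t = algebraMap A Ω π * z := by
  constructor
  · rintro ⟨s, rfl⟩
    refine ⟨_, hT.algebraMap_mem s, hT.isIntegral_algebraMap s, ?_⟩
    rw [map_mul, ← IsScalarTower.algebraMap_apply]
  · rintro ⟨z, hzL, hz, h⟩
    obtain ⟨s, rfl⟩ := (hT z).mpr ⟨hz, hzL⟩
    refine ⟨s, FaithfulSMul.algebraMap_injective T Ω ?_⟩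
    rw [map_mul, ← IsScalarTower.algebraMap_apply, h]

variable [Algebra A K] [IsFractionRing A K] [IsScalarTower A K Ω]

omit hT in
include K in
lemma faithfulSMul_base : FaithfulSMul A Ω := by
  rw [faithfulSMul_iff_algebraMap_injective, IsScalarTower.algebraMap_eq A K Ω]
  exact (algebraMap K Ω).injective.comp (FaithfulSMul.algebraMap_injective A K)

variable [IsIntegrallyClosed A]

lemma dvd_of_algebraMap_dvd {π r : A} (hπ : π ≠ 0) (h : algebraMap A T π ∣ algebraMap A T r) :
    π ∣ r := by
  have := faithfulSMul_base (A := A) (K := K) (Ω := Ω)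
  have hinj := FaithfulSMul.algebraMap_injective A K
  have hπK : algebraMap A K π ≠ 0 := (map_ne_zero_iff _ hinj).mpr hπ
  obtain ⟨z, -, hz, h⟩ := hT.dvd_iff.mp h
  have h1 : z = algebraMap K Ω (algebraMap A K r / algebraMap A K π) := by
    rw [map_div₀, eq_div_iff ((map_ne_zero _).mpr hπK), mul_comm,
      ← IsScalarTower.algebraMap_apply, ← IsScalarTower.algebraMap_apply, ← h,
      ← IsScalarTower.algebraMap_apply]
  rw [h1, isIntegral_algebraMap_iff (algebraMap K Ω).injective] at hz
  obtain ⟨s, hs⟩ := IsIntegrallyClosed.isIntegral_iff.mp hz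
  refine ⟨s, hinj ?_⟩
  rw [map_mul, hs, mul_div_cancel₀ _ hπK]

variable [IsDomain A]

/-- For z = t/π both π z and a z are integral over A, hence so is z. -/
lemma dvd_of_dvd_mul [Algebra.IsAlgebraic K Ω] {π a : A} (hπ : Prime π) (ha : ¬ π ∣ a) {t : T}
    (h : algebraMap A T π ∣ algebraMap A T a * t) : algebraMap A T π ∣ t := by
  have := faithfulSMul_base (A := A) (K := K) (Ω := Ω)
  have hπΩ : algebraMap A Ω π ≠ 0 :=
    (map_ne_zero_iff _ (FaithfulSMul.algebraMap_injective A Ω)).mpr hπ.ne_zero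
  have haΩ : algebraMap A Ω a ≠ 0 := by
    refine (map_ne_zero_iff _ (FaithfulSMul.algebraMap_injective A Ω)).mpr ?_
    rintro rfl
    exact ha (dvd_zero _)
  obtain ⟨z, hzL, hz, h⟩ := hT.dvd_iff.mp h
  rw [map_mul, ← IsScalarTower.algebraMap_apply] at h
  have hw : algebraMap T Ω t = algebraMap A Ω π * (algebraMap T Ω t / algebraMap A Ω π) :=
    (mul_div_cancel₀ _ hπΩ).symm
  refine hT.dvd_iff.mpr ⟨_, ?_, ?_, hw⟩
  · refine div_mem (hT.algebraMap_mem t) ?_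
    rw [IsScalarTower.algebraMap_apply A K Ω]
    exact L.algebraMap_mem _
  · refine isIntegral_of_isIntegral_mul K hπ ha (hw ▸ hT.isIntegral_algebraMap t) ?_
    rwa [← mul_div_assoc, h, mul_div_cancel_left₀ _ hπΩ]

lemma dvd_of_dvd_mul_of_isUnitModAway [Algebra.IsAlgebraic K Ω] {π a m : A} (hπ : Prime π)
    (ha : ¬ π ∣ a) (hm : IsUnitModAway π a m) {t : T}
    (h : algebraMap A T π ∣ algebraMap A T m * t) : algebraMap A T π ∣ t := by
  obtain ⟨k, c, hk⟩ := hm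
  refine hT.dvd_of_dvd_mul hπ (fun h ↦ ha (hπ.dvd_of_dvd_pow h)) (a := a ^ k) ?_
  have h1 : algebraMap A T (a ^ k) * t =
      algebraMap A T (a ^ k - m * c) * t + algebraMap A T c * (algebraMap A T m * t) := by
    rw [map_sub, map_mul]
    ring
  rw [h1]
  exact dvd_add ((map_dvd _ hk).mul_right _) (h.mul_left _)

end General

/-! ### Lifting the q-th power map to T. -/

section LiftFrobenius

variable {A T K Ω : Type*} [CommRing A] [IsDomain A] [CommRing T] [Field K] [Field Ω]
  [Algebra K Ω] [Algebra A Ω] [Algebra T Ω] [Algebra A K] [IsFractionRing A K]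
  [IsScalarTower A K Ω] {π a : A} (hT : IsIntegralClosureIn A T (galoisFamilyUnion K Ω π a))

include hT

lemma exists_algebraMap_eq {φ : A ≃+* A} {Φ : Ω ≃+* Ω}
    (hΦ : ∀ r, Φ (algebraMap A Ω r) = algebraMap A Ω (φ r))
    (hφ : ∀ m, IsUnitModAway π a m → IsUnitModAway π a (φ m)) (t : T) :
    ∃ t', algebraMap T Ω t' = Φ (algebraMap T Ω t) :=
  (hT _).mpr ⟨(hT.isIntegral_algebraMap t).map_semilinear hΦ,
    map_mem_galoisFamilyUnion hΦ hφ (hT.algebraMap_mem t)⟩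

variable [IsIntegrallyClosed A] [Algebra A T] [IsScalarTower A T Ω] [FaithfulSMul T Ω]
  [IsGalois K Ω]

/-- Two homomorphisms from `T` to a domain that agree on `A` differ by an automorphism. -/
lemma exists_forall_apply_eq {D : Type*} [CommRing D] [IsDomain D] {f g : T →+* D}
    (h : ∀ r, f (algebraMap A T r) = g (algebraMap A T r)) :
    ∃ σ : Gal(Ω/K), ∀ t t', algebraMap T Ω t' = σ (algebraMap T Ω t) → g t = f t' := by
  have hinj := FaithfulSMul.algebraMap_injective T Ω
  have hex : ∀ (σ : Gal(Ω/K)) (t : T), ∃ t', algebraMap T Ω t' = σ (algebraMap T Ω t) :=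
    fun σ ↦ hT.exists_algebraMap_eq (galEquiv_algebraMap σ) fun _ h ↦ h
  let ρ : Gal(Ω/K) → T →+* T := fun σ ↦
    ((σ : Ω →+* Ω).comp (algebraMap T Ω)).descend (hex σ)
  have hρ : ∀ σ t, algebraMap T Ω (ρ σ t) = σ (algebraMap T Ω t) := fun σ t ↦
    RingHom.algebraMap_descend _ (hex σ) t
  let : MulSemiringAction Gal(Ω/K) T :=
    { smul := fun σ t ↦ ρ σ t
      one_smul := fun t ↦ hinj (hρ 1 t)
      mul_smul := fun σ τ t ↦ hinj ((hρ (σ * τ) t).trans (by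
        change σ (τ _) = algebraMap T Ω (ρ σ (ρ τ t))
        rw [hρ, hρ]))
      smul_zero := fun σ ↦ map_zero (ρ σ)
      smul_add := fun σ ↦ map_add (ρ σ)
      smul_one := fun σ ↦ map_one (ρ σ)
      smul_mul := fun σ ↦ map_mul (ρ σ) }
  have hsmul : ∀ (σ : Gal(Ω/K)) (t : T), algebraMap T Ω (σ • t) = σ (algebraMap T Ω t) := hρ
  have hopen : ∀ t : T, IsOpen (MulAction.stabilizer Gal(Ω/K) t : Set Gal(Ω/K)) := by
    intro t
    have : MulAction.stabilizer Gal(Ω/K) t =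
        MulAction.stabilizer Gal(Ω/K) (algebraMap T Ω t) := by
      ext σ
      rw [MulAction.mem_stabilizer_iff, MulAction.mem_stabilizer_iff, ← hinj.eq_iff, hsmul]
      rfl
    rw [this]
    exact stabilizer_isOpen_of_isIntegral _
  obtain ⟨σ, hσ⟩ := exists_forall_apply_smul_eq (G := Gal(Ω/K)) hopen (f := f) (g := g)
      fun t ht ↦ by
    -- An invariant element of T lies in K and is integral over A, so it lies in A, where f and g
    -- agree.
    obtain ⟨k, hk⟩ := (InfiniteGalois.mem_range_algebraMap_iff_fixed (k := K) _).mpr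
      fun σ ↦ (hsmul σ t).symm.trans (congrArg _ (ht σ))
    have h1 := hT.isIntegral_algebraMap t
    rw [← hk, isIntegral_algebraMap_iff (algebraMap K Ω).injective] at h1
    obtain ⟨r, rfl⟩ := IsIntegrallyClosed.isIntegral_iff.mp h1
    have : t = algebraMap A T r := hinj (by
      rw [← hk, ← IsScalarTower.algebraMap_apply, ← IsScalarTower.algebraMap_apply])
    rw [this, h]
  refine ⟨σ, fun t t' ht' ↦ ?_⟩
  rw [hσ, hinj (ht'.trans (hsmul σ t).symm)]

/-- A lift `φ` of the `q`-th power map on `A/π` extends to a lift of the `q`-th power map on `T/P`,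
for every prime ideal `P` of `T` over `π`. -/
theorem exists_lift_frobenius {p : ℕ} [Fact p.Prime] {e : ℕ} {φ : A ≃+* A} {Φ₁ : Ω ≃+* Ω}
    (hΦ₁ : ∀ r, Φ₁ (algebraMap A Ω r) = algebraMap A Ω (φ r)) (hφπ : φ π = π)
    (hφ : ∀ r, π ∣ φ r - r ^ p ^ e) (P : Ideal T) [P.IsPrime] (hP : algebraMap A T π ∈ P)
    (hp : (p : T) ∈ P) :
    ∃ Φ : T ≃+* T, Ideal.map Φ P = P ∧
      ∀ t, Ideal.Quotient.mk P (Φ t) = Ideal.Quotient.mk P t ^ p ^ e := by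
  have hinj := FaithfulSMul.algebraMap_injective T Ω
  have : CharP (T ⧸ P) p := .of_prime_of_natCast_eq_zero Fact.out (by
    rw [← map_natCast (Ideal.Quotient.mk P), Ideal.Quotient.eq_zero_iff_mem]
    exact hp)
  have h1 := hT.exists_algebraMap_eq hΦ₁ fun _ h ↦ h.map_of_dvd_sub_pow hφπ hφ
  have h2 := hT.exists_algebraMap_eq (RingEquiv.symm_semilinear hΦ₁)
    fun _ h ↦ h.symm_map_of_dvd_sub_pow (pow_ne_zero e (Fact.out : p.Prime).ne_zero) hφ
  let F₁ : T →+* T := ((Φ₁ : Ω →+* Ω).comp (algebraMap T Ω)).descend h1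
  have hF₁ : ∀ t, algebraMap T Ω (F₁ t) = Φ₁ (algebraMap T Ω t) :=
    RingHom.algebraMap_descend _ h1
  have hF₁A : ∀ r, F₁ (algebraMap A T r) = algebraMap A T (φ r) := fun r ↦ hinj (by
    rw [hF₁, ← IsScalarTower.algebraMap_apply, hΦ₁, ← IsScalarTower.algebraMap_apply])
  -- Φ₁ is right on A but may permute the primes over π. The Galois element σ corrects this, and the
  -- lift is Φ₁ ∘ σ, which preserves P because it is the q-th power map modulo P.
  obtain ⟨σ, hσ⟩ := hT.exists_forall_apply_eq (f := (Ideal.Quotient.mk P).comp F₁)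
    (g := (iterateFrobenius (T ⧸ P) p e).comp (Ideal.Quotient.mk P)) fun r ↦ by
      rw [RingHom.comp_apply, RingHom.comp_apply, hF₁A, iterateFrobenius_def, ← map_pow,
        Ideal.Quotient.eq, ← map_pow, ← map_sub]
      exact Ideal.mem_of_dvd _ (map_dvd _ (hφ r)) hP
  have hs := hT.exists_algebraMap_eq (galEquiv_algebraMap (A := A) σ) fun _ h ↦ h
  have hs' := hT.exists_algebraMap_eq (galEquiv_algebraMap (A := A) σ⁻¹) fun _ h ↦ h
  have h3 : ∀ t, ∃ t', algebraMap T Ω t' =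
      (((σ : Ω ≃+* Ω).trans Φ₁ : Ω →+* Ω).comp (algebraMap T Ω)) t := by
    intro t
    obtain ⟨t', ht'⟩ := hs t
    obtain ⟨t'', ht''⟩ := h1 t'
    exact ⟨t'', ht''.trans (congrArg Φ₁ ht')⟩
  have h4 : ∀ t, ∃ t', algebraMap T Ω t' =
      (((σ : Ω ≃+* Ω).trans Φ₁).symm : Ω →+* Ω).comp (algebraMap T Ω) t := by
    intro t
    obtain ⟨t', ht'⟩ := h2 t
    obtain ⟨t'', ht''⟩ := hs' t'
    exact ⟨t'', ht''.trans (congrArg (fun z ↦ σ⁻¹ z) ht')⟩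
  let Φ : T ≃+* T := RingEquiv.ofRingHom (RingHom.descend _ h3) (RingHom.descend _ h4)
    (RingHom.ext fun t ↦ hinj (by
      change algebraMap T Ω (RingHom.descend _ h3 (RingHom.descend _ h4 t)) = algebraMap T Ω t
      rw [RingHom.algebraMap_descend]
      change ((σ : Ω ≃+* Ω).trans Φ₁) (algebraMap T Ω (RingHom.descend _ h4 t)) = _
      rw [RingHom.algebraMap_descend]
      exact ((σ : Ω ≃+* Ω).trans Φ₁).apply_symm_apply _))
    (RingHom.ext fun t ↦ hinj (by
      change algebraMap T Ω (RingHom.descend _ h4 (RingHom.descend _ h3 t)) = algebraMap T Ω t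
      rw [RingHom.algebraMap_descend]
      change ((σ : Ω ≃+* Ω).trans Φ₁).symm (algebraMap T Ω (RingHom.descend _ h3 t)) = _
      rw [RingHom.algebraMap_descend]
      exact ((σ : Ω ≃+* Ω).trans Φ₁).symm_apply_apply _))
  have hΦ : ∀ t, algebraMap T Ω (Φ t) = Φ₁ (σ (algebraMap T Ω t)) :=
    RingHom.algebraMap_descend _ h3
  have key : ∀ t, Ideal.Quotient.mk P (Φ t) = Ideal.Quotient.mk P t ^ p ^ e := by
    intro t
    obtain ⟨t', ht'⟩ := hs t
    have h5 := hσ t t' ht'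
    rw [RingHom.comp_apply, RingHom.comp_apply, iterateFrobenius_def] at h5
    rw [h5]
    congr 1
    exact hinj (by rw [hΦ, hF₁, ht']; rfl)
  refine ⟨Φ, ?_, key⟩
  have hmem : ∀ t, Φ t ∈ P ↔ t ∈ P := fun t ↦ by
    rw [← Ideal.Quotient.eq_zero_iff_mem, key, ← Ideal.Quotient.eq_zero_iff_mem,
      pow_eq_zero_iff (pow_ne_zero e (Fact.out : p.Prime).ne_zero)]
  refine le_antisymm (Ideal.map_le_iff_le_comap.mpr fun t ht ↦ (hmem t).mpr ht) fun t ht ↦ ?_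
  rw [← Φ.apply_symm_apply t] at ht ⊢
  exact Ideal.mem_map_of_mem Φ ((hmem _).mp ht)

end LiftFrobenius

end IsIntegralClosureIn

/-! ### The ring B/ϖB[1/α] and its base change property. -/

namespace ModAway

open scoped TensorProduct

section Basic

variable {B : Type*} [CommRing B] (ϖ α : B)

/-- The canonical map `B → B/ϖB[1/α]`. -/
noncomputable def of : B →+* ModAway B ϖ α :=
  (algebraMap (B ⧸ Ideal.span {ϖ}) _).comp (Ideal.Quotient.mk _)

variable {ϖ α}

lemma of_self_eq_zero : of ϖ α ϖ = 0 := by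
  rw [of, RingHom.comp_apply,
    Ideal.Quotient.eq_zero_iff_mem.mpr (Ideal.mem_span_singleton_self ϖ), map_zero]

lemma of_eq_zero_of_dvd {b : B} (h : ϖ ∣ b) : of ϖ α b = 0 := by
  obtain ⟨c, rfl⟩ := h
  rw [map_mul, of_self_eq_zero, zero_mul]

lemma isUnit_of : IsUnit (of ϖ α α) :=
  IsLocalization.Away.algebraMap_isUnit (Ideal.Quotient.mk (Ideal.span {ϖ}) α)

lemma of_eq_zero_iff {b : B} : of ϖ α b = 0 ↔ ∃ k : ℕ, ϖ ∣ α ^ k * b := by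
  constructor
  · intro h
    obtain ⟨⟨_, k, rfl⟩, hk⟩ := (IsLocalization.map_eq_zero_iff
      (Submonoid.powers (Ideal.Quotient.mk (Ideal.span {ϖ}) α)) _ _).mp h
    refine ⟨k, ?_⟩
    rw [← Ideal.mem_span_singleton, ← Ideal.Quotient.eq_zero_iff_mem, map_mul, map_pow]
    exact hk
  · rintro ⟨k, hk⟩
    have h := of_eq_zero_of_dvd (α := α) hk
    rwa [map_mul, map_pow, (isUnit_of.pow k).mul_right_eq_zero] at h

lemma exists_of_eq_mul (e : ModAway B ϖ α) : ∃ (b : B) (k : ℕ), of ϖ α b = e * of ϖ α α ^ k := by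
  obtain ⟨k, b, h⟩ := IsLocalization.Away.surj (Ideal.Quotient.mk (Ideal.span {ϖ}) α) e
  obtain ⟨b, rfl⟩ := Ideal.Quotient.mk_surjective b
  exact ⟨b, k, h.symm⟩

lemma ringHom_ext {C : Type*} [CommRing C] {f g : ModAway B ϖ α →+* C}
    (h : ∀ b, f (of ϖ α b) = g (of ϖ α b)) : f = g :=
  IsLocalization.ringHom_ext (Submonoid.powers (Ideal.Quotient.mk (Ideal.span {ϖ}) α))
    (Ideal.Quotient.ringHom_ext (RingHom.ext h))

/-- Ring homomorphisms out of `B/ϖB[1/α]`. -/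
noncomputable def lift {C : Type*} [CommRing C] (f : B →+* C) (h : f ϖ = 0) (h' : IsUnit (f α)) :
    ModAway B ϖ α →+* C :=
  IsLocalization.Away.lift (Ideal.Quotient.mk (Ideal.span {ϖ}) α)
    (g := Ideal.Quotient.lift (Ideal.span {ϖ}) f (by
      intro b hb
      obtain ⟨c, rfl⟩ := Ideal.mem_span_singleton.mp hb
      rw [map_mul, h, zero_mul]))
    (by rwa [Ideal.Quotient.lift_mk])

lemma lift_of {C : Type*} [CommRing C] (f : B →+* C) (h : f ϖ = 0) (h' : IsUnit (f α)) (b : B) :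
    lift f h h' (of ϖ α b) = f b :=
  IsLocalization.Away.lift_eq _ _ _

lemma map_of {C : Type*} [CommRing C] (j : B →+* C) (b : B) :
    map j ϖ α (of ϖ α b) = of (j ϖ) (j α) (j b) :=
  IsLocalization.Away.lift_eq _ _ _

end Basic

section Algebra

variable {A : Type*} [CommRing A] (π a : A) (B : Type*) [CommRing B] [Algebra A B]

/-- `B/πB[1/a]` for an algebra `B` over `A ∋ π, a`. -/
abbrev Over : Type _ := ModAway B (algebraMap A B π) (algebraMap A B a)

noncomputable instance algebraOver : Algebra (ModAway A π a) (Over π a B) :=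
  (map (algebraMap A B) π a).toAlgebra

lemma algebraMap_over_of (r : A) :
    algebraMap (ModAway A π a) (Over π a B) (of π a r) =
      of (algebraMap A B π) (algebraMap A B a) (algebraMap A B r) :=
  map_of _ r

instance isScalarTower_over : IsScalarTower A (ModAway A π a) (Over π a B) :=
  .of_algebraMap_eq fun r ↦ (algebraMap_over_of π a B r).symm

variable {B}

lemma algebraMap_of_isUnit (C : Type*) [CommRing C] [Algebra (ModAway A π a) C] [Algebra A C]
    [IsScalarTower A (ModAway A π a) C] : algebraMap A C π = 0 ∧ IsUnit (algebraMap A C a) := by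
  rw [IsScalarTower.algebraMap_apply A (ModAway A π a), IsScalarTower.algebraMap_apply A
    (ModAway A π a) C a]
  exact ⟨(congrArg _ of_self_eq_zero).trans (map_zero _), isUnit_of.map _⟩

/-- Algebra homomorphisms out of `B/πB[1/a]`. -/
noncomputable def overLift {C : Type*} [CommRing C] [Algebra (ModAway A π a) C] [Algebra A C]
    [IsScalarTower A (ModAway A π a) C] (f : B →ₐ[A] C) : Over π a B →ₐ[ModAway A π a] C :=
  have h1 : (f : B →+* C) (algebraMap A B π) = 0 :=
    (f.commutes π).trans (algebraMap_of_isUnit π a C).1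
  have h2 : IsUnit ((f : B →+* C) (algebraMap A B a)) :=
    (f.commutes a).symm ▸ (algebraMap_of_isUnit π a C).2
  { lift (f : B →+* C) h1 h2 with
    commutes' := fun r ↦ by
      refine RingHom.congr_fun (f := (lift (f : B →+* C) h1 h2).comp (algebraMap _ _))
        (g := algebraMap (ModAway A π a) C) (ringHom_ext fun r ↦ ?_) r
      rw [RingHom.comp_apply, algebraMap_over_of, lift_of]
      exact (f.commutes r).trans (IsScalarTower.algebraMap_apply A (ModAway A π a) C r) }

lemma overLift_of {C : Type*} [CommRing C] [Algebra (ModAway A π a) C] [Algebra A C]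
    [IsScalarTower A (ModAway A π a) C] (f : B →ₐ[A] C) (b : B) :
    overLift π a f (of _ _ b) = f b :=
  lift_of (f : B →+* C) ((f.commutes π).trans (algebraMap_of_isUnit π a C).1)
    ((f.commutes a).symm ▸ (algebraMap_of_isUnit π a C).2) b

variable (B)

instance isPushout_over : Algebra.IsPushout A (ModAway A π a) B (Over π a B) where
  out := by
    let f : ModAway A π a ⊗[A] B →ₐ[ModAway A π a] Over π a B :=
      Algebra.TensorProduct.lift (Algebra.ofId _ _) (IsScalarTower.toAlgHom A B _)
        fun _ _ ↦ Commute.all _ _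
    let g : Over π a B →ₐ[ModAway A π a] ModAway A π a ⊗[A] B :=
      overLift π a Algebra.TensorProduct.includeRight
    have hf : ∀ b : B, f (1 ⊗ₜ b) = of _ _ b := fun b ↦ by
      rw [Algebra.TensorProduct.lift_tmul, map_one, one_mul]
      rfl
    have hg : ∀ b : B, g (of _ _ b) = 1 ⊗ₜ b := fun b ↦ overLift_of π a _ b
    refine .of_equiv (AlgEquiv.ofAlgHom f g ?_ ?_).toLinearEquiv hf
    · refine AlgHom.coe_ringHom_injective (ringHom_ext fun b ↦ ?_)
      change f (g _) = of _ _ b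
      rw [hg, hf]
    · refine Algebra.TensorProduct.ext (by ext) (AlgHom.ext fun b ↦ ?_)
      change g (f (1 ⊗ₜ b)) = 1 ⊗ₜ b
      rw [hf, hg]

end Algebra

end ModAway

lemma IsUnitModAway.isUnit_of {A : Type*} [CommRing A] {π a m : A} (h : IsUnitModAway π a m) :
    IsUnit (ModAway.of π a m) := by
  obtain ⟨k, c, hk⟩ := h
  have h1 := ModAway.of_eq_zero_of_dvd (α := a) hk
  rw [map_sub, map_mul, map_pow, sub_eq_zero] at h1
  exact isUnit_of_mul_isUnit_left (h1 ▸ ModAway.isUnit_of.pow k)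

lemma exists_isGalois_hasGaloisFamily {A K Ω : Type*} [CommRing A] [IsDomain A] [Field K]
    [Field Ω] [Algebra K Ω] [Algebra A Ω] [Algebra A K] [IsFractionRing A K] [IsScalarTower A K Ω]
    [IsGalois K Ω] {π a : A} (hπ : Prime π) (ha : ¬ π ∣ a)
    {N : IntermediateField K Ω}
    (hN : N.HasGaloisFamily π a) :
    ∃ N' : IntermediateField K Ω, N ≤ N' ∧ N'.HasGaloisFamily π a ∧ FiniteDimensional K N' ∧
      IsGalois K N' := by
  have := hN.finiteDimensional hπ ha
  exact ⟨IntermediateField.normalClosure K N Ω, IntermediateField.le_normalClosure N,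
    hN.normalClosure hπ ha, inferInstance, inferInstance⟩

/-! ### (T/π)[1/a] as a union of finite étale algebras; reducedness and perfectness. -/

namespace IsIntegralClosureIn

variable {A T K Ω : Type*} [CommRing A] [CommRing T] [Algebra A T] [Field K] [Field Ω]
  [Algebra K Ω] [Algebra A Ω] [Algebra T Ω] [Algebra A K] [IsScalarTower A T Ω] [FaithfulSMul T Ω]
  [IsScalarTower A K Ω] {π a : A} (hT : IsIntegralClosureIn A T (galoisFamilyUnion K Ω π a))

/-- The inclusion of the integral elements of an intermediate field with a Galois family. -/
noncomputable def inclusion {N : IntermediateField K Ω} (hN : N.HasGaloisFamily π a) :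
    integralClosure A N →ₐ[A] T :=
  have h : ∀ b, ∃ t, algebraMap T Ω t =
      ((algebraMap N Ω).comp (algebraMap (integralClosure A N) N)) b := fun b ↦
    (hT _).mpr ⟨b.2.map (N.val.restrictScalars A), N, hN, b.1.2⟩
  { RingHom.descend _ h with
    commutes' := fun r ↦ FaithfulSMul.algebraMap_injective T Ω (by
      refine (RingHom.algebraMap_descend _ h _).trans ?_
      rw [← IsScalarTower.algebraMap_apply]
      rfl) }

lemma algebraMap_inclusion {N : IntermediateField K Ω} (hN : N.HasGaloisFamily π a)
    (b : integralClosure A N) : algebraMap T Ω (hT.inclusion hN b) = ((b : N) : Ω) :=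
  RingHom.algebraMap_descend _ _ b

lemma exists_inclusion_eq {N : IntermediateField K Ω} (hN : N.HasGaloisFamily π a) {t : T}
    (ht : algebraMap T Ω t ∈ N) : ∃ b, hT.inclusion hN b = t := by
  have : IsIntegral A (⟨_, ht⟩ : N) :=
    (isIntegral_algHom_iff (N.val.restrictScalars A) N.val.injective).mp
      (hT.isIntegral_algebraMap t)
  exact ⟨⟨_, this⟩, FaithfulSMul.algebraMap_injective T Ω (hT.algebraMap_inclusion hN _)⟩

/-- The map induced by `inclusion` modulo `π` and away from `a`. -/
noncomputable def overInclusion {N : IntermediateField K Ω} (hN : N.HasGaloisFamily π a) :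
    ModAway.Over π a (integralClosure A N) →ₐ[ModAway A π a] ModAway.Over π a T :=
  ModAway.overLift π a ((IsScalarTower.toAlgHom A T _).comp (hT.inclusion hN))

lemma overInclusion_of {N : IntermediateField K Ω} (hN : N.HasGaloisFamily π a)
    (b : integralClosure A N) :
    hT.overInclusion hN (ModAway.of _ _ b) = ModAway.of _ _ (hT.inclusion hN b) :=
  ModAway.overLift_of _ _ _ b

lemma overInclusion_mem_range {N : IntermediateField K Ω}
    (hN : N.HasGaloisFamily π a) {e : ModAway.Over π a T} {t : T} {k : ℕ}
    (h : ModAway.of _ _ t = e * ModAway.of _ _ (algebraMap A T a) ^ k)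
    (ht : algebraMap T Ω t ∈ N) : e ∈ (hT.overInclusion hN).range := by
  obtain ⟨b, rfl⟩ := hT.exists_inclusion_eq hN ht
  have hu : IsUnit (ModAway.of (algebraMap A (integralClosure A N) π)
    (algebraMap A (integralClosure A N) a) (algebraMap A (integralClosure A N) a)) :=
    ModAway.isUnit_of
  obtain ⟨u, hu⟩ := hu.pow k
  refine ⟨ModAway.of (algebraMap A (integralClosure A N) π)
    (algebraMap A (integralClosure A N) a) b * ↑u⁻¹, ?_⟩
  have h1 : hT.overInclusion hN u = ModAway.of _ _ (algebraMap A T a) ^ k := by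
    rw [hu, map_pow, overInclusion_of, AlgHom.commutes]
  change hT.overInclusion hN (_ * _) = e
  rw [map_mul, overInclusion_of, h, ← h1, mul_assoc, ← map_mul, Units.mul_inv, map_one, mul_one]

lemma range_overInclusion_mono {N N' : IntermediateField K Ω} (hN : N.HasGaloisFamily π a)
    (hN' : N'.HasGaloisFamily π a) (h : N ≤ N') :
    (hT.overInclusion hN).range ≤ (hT.overInclusion hN').range := by
  rintro _ ⟨x, rfl⟩
  obtain ⟨b, k, hb⟩ := ModAway.exists_of_eq_mul x
  refine hT.overInclusion_mem_range hN' (t := hT.inclusion hN b) (k := k) ?_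
    (h (hT.algebraMap_inclusion hN b ▸ b.1.2))
  rw [← overInclusion_of, hb, map_mul, map_pow, overInclusion_of, AlgHom.commutes]
  rfl

variable [IsFractionRing A K]

/-- The quotient by π stays in the field N and is integral. Hence B/π → T/π is injective, and it
stays so after inverting a. -/
lemma dvd_of_dvd_inclusion (hπ : π ≠ 0) {N : IntermediateField K Ω} (hN : N.HasGaloisFamily π a)
    {b : integralClosure A N} (h : algebraMap A T π ∣ hT.inclusion hN b) :
    algebraMap A (integralClosure A N) π ∣ b := by
  have := faithfulSMul_base (A := A) (K := K) (Ω := Ω)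
  have hπΩ : algebraMap A Ω π ≠ 0 :=
    (map_ne_zero_iff _ (FaithfulSMul.algebraMap_injective A Ω)).mpr hπ
  obtain ⟨s, hs⟩ := h
  have h1 := congrArg (algebraMap T Ω) hs
  rw [map_mul, algebraMap_inclusion, ← IsScalarTower.algebraMap_apply] at h1
  have h2 : algebraMap T Ω s ∈ N := by
    rw [← mul_div_cancel_left₀ (algebraMap T Ω s) hπΩ, ← h1]
    refine div_mem (b : N).2 ?_
    rw [IsScalarTower.algebraMap_apply A K Ω]
    exact N.algebraMap_mem _
  obtain ⟨c, rfl⟩ := hT.exists_inclusion_eq hN h2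
  refine ⟨c, Subtype.ext (Subtype.ext ?_)⟩
  rw [h1, algebraMap_inclusion]
  rfl

lemma overInclusion_injective (hπ : π ≠ 0) {N : IntermediateField K Ω}
    (hN : N.HasGaloisFamily π a) : Function.Injective (hT.overInclusion hN) := by
  rw [injective_iff_map_eq_zero]
  intro e he
  obtain ⟨b, k, hb⟩ := ModAway.exists_of_eq_mul e
  have h1 : hT.overInclusion hN (ModAway.of _ _ b) = 0 := by rw [hb, map_mul, he, zero_mul]
  rw [overInclusion_of, ModAway.of_eq_zero_iff] at h1
  obtain ⟨l, hl⟩ := h1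
  rw [← AlgHom.commutes (hT.inclusion hN) a, ← map_pow, ← map_mul] at hl
  have h2 : ModAway.of (algebraMap A (integralClosure A N) π) (algebraMap A _ a) b = 0 :=
    ModAway.of_eq_zero_iff.mpr ⟨l, hT.dvd_of_dvd_inclusion hπ hN hl⟩
  rw [hb] at h2
  exact (ModAway.isUnit_of.pow k).mul_left_eq_zero.mp h2

variable [IsIntegrallyClosed A]

include hT in
lemma charP_quotient {p : ℕ} [Fact p.Prime] (hπ : Prime π) (hp : π ∣ (p : A)) :
    CharP (T ⧸ Ideal.span {algebraMap A T π}) p := by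
  refine charP_quotient_span_singleton (fun h ↦ hπ.not_isUnit (isUnit_of_dvd_one
    (hT.dvd_of_algebraMap_dvd hπ.ne_zero h.dvd))) Fact.out ?_
  rw [← map_natCast (algebraMap A T)]
  exact map_dvd _ hp

include hT in
lemma charP_quotient_integralClosure {p : ℕ} [Fact p.Prime] (hπ : Prime π) (hp : π ∣ (p : A))
    {N : IntermediateField K Ω}
    (hN : N.HasGaloisFamily π a) :
    CharP (integralClosure A N ⧸ Ideal.span {algebraMap A (integralClosure A N) π}) p := by
  refine charP_quotient_span_singleton (fun h ↦ hπ.not_isUnit (isUnit_of_dvd_one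
    (hT.dvd_of_algebraMap_dvd hπ.ne_zero ?_))) Fact.out ?_
  · have h1 : algebraMap A (integralClosure A N) π ∣ 1 := h.dvd
    simpa using map_dvd (hT.inclusion hN) h1
  · rw [← map_natCast (algebraMap A (integralClosure A N))]
    exact map_dvd _ hp

variable [IsDomain A] [IsGalois K Ω]

section Frobenius

variable {p : ℕ} [Fact p.Prime] (hπ : Prime π) (ha : ¬ π ∣ a) (hp : π ∣ (p : A))

include hT hπ ha hp

/-- Each element of T lies in a finite Galois N with Galois coordinates. There m kills nilpotents
modulo π, and m can be cancelled in T/π. -/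
lemma isReduced_quotient : IsReduced (T ⧸ Ideal.span {algebraMap A T π}) := by
  refine (isReduced_iff_pow_one_lt p (Fact.out : p.Prime).one_lt).mpr fun x hx ↦ ?_
  obtain ⟨t, rfl⟩ := Ideal.Quotient.mk_surjective x
  rw [← map_pow, Ideal.Quotient.eq_zero_iff_mem, Ideal.mem_span_singleton] at hx
  rw [Ideal.Quotient.eq_zero_iff_mem, Ideal.mem_span_singleton]
  obtain ⟨N, hN, htN⟩ := hT.algebraMap_mem t
  obtain ⟨N, hle, hN, _, _⟩ := exists_isGalois_hasGaloisFamily hπ ha hN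
  obtain ⟨b, rfl⟩ := hT.exists_inclusion_eq hN (hle htN)
  obtain ⟨ι, _, D, hD⟩ := hN.exists_galoisCoordinates
  have hdvd : ∀ r : A, algebraMap A (integralClosure A N) π ∣ algebraMap A _ r → π ∣ r :=
    fun r hr ↦ hT.dvd_of_algebraMap_dvd hπ.ne_zero (by
      simpa using map_dvd (hT.inclusion hN) hr)
  have := hT.charP_quotient_integralClosure (p := p) hπ hp hN
  rw [← map_pow] at hx
  have h1 := map_dvd (hT.inclusion hN) (D.dvd_mul_of_dvd_pow hπ hdvd
    (hT.dvd_of_dvd_inclusion hπ.ne_zero hN hx))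
  rw [map_mul, AlgHom.commutes, AlgHom.commutes] at h1
  exact hT.dvd_of_dvd_mul_of_isUnitModAway hπ ha hD h1

/-- Injectivity is reducedness. For surjectivity write e = b/a^k, take s with s^p ≡ m^p b and a'
with a'^p ≡ a modulo π; then s/(m a'^k) is a p-th root of e. -/
lemma bijective_pow_modAway (hA : ∀ r : A, ∃ s, π ∣ s ^ p - r) :
    Function.Bijective fun x : ModAway.Over π a T ↦ x ^ p := by
  have := hT.charP_quotient hπ hp
  have := hT.isReduced_quotient hπ ha hp
  have hnt : Nontrivial (ModAway.Over π a T) := by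
    refine nontrivial_of_ne 1 0 fun h ↦ ha ?_
    rw [← map_one (ModAway.of _ _), ModAway.of_eq_zero_iff] at h
    obtain ⟨k, hk⟩ := h
    rw [mul_one, ← map_pow] at hk
    exact hπ.dvd_of_dvd_pow (hT.dvd_of_algebraMap_dvd hπ.ne_zero hk)
  have hpE : (p : ModAway.Over π a T) = 0 := by
    rw [← map_natCast (algebraMap A (ModAway.Over π a T))]
    exact ModAway.of_eq_zero_of_dvd (map_dvd _ hp)
  have : CharP (ModAway.Over π a T) p := .of_prime_of_natCast_eq_zero Fact.out hpE
  have : IsReduced (ModAway.Over π a T) :=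
    inferInstanceAs (IsReduced (Localization _))
  refine ⟨frobenius_inj _ p, fun e ↦ ?_⟩
  obtain ⟨t, k, hk⟩ := ModAway.exists_of_eq_mul e
  obtain ⟨N, hN, htN⟩ := hT.algebraMap_mem t
  obtain ⟨N, hle, hN, _, _⟩ := exists_isGalois_hasGaloisFamily hπ ha hN
  obtain ⟨b, rfl⟩ := hT.exists_inclusion_eq hN (hle htN)
  obtain ⟨ι, _, D, hD⟩ := hN.exists_galoisCoordinates
  have := hT.charP_quotient_integralClosure (p := p) hπ hp hN
  obtain ⟨s, hs⟩ := D.exists_pow_congr hA b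
  obtain ⟨a', ha'⟩ := hA a
  let ρ : A →+* ModAway.Over π a T := (algebraMap (ModAway A π a) _).comp (ModAway.of π a)
  have hρ : ∀ r, ρ r = ModAway.of _ _ (algebraMap A T r) := ModAway.algebraMap_over_of π a T
  have h1 : ρ a' ^ p = ρ a := by
    have := congrArg (algebraMap (ModAway A π a) (ModAway.Over π a T))
      (ModAway.of_eq_zero_of_dvd (α := a) ha')
    rw [map_zero, map_sub, map_sub, sub_eq_zero, map_pow, map_pow] at this
    exact this
  have h2 : IsUnit (ρ a') := by
    rw [← isUnit_pow_iff (Fact.out : p.Prime).ne_zero, h1, hρ]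
    exact ModAway.isUnit_of
  have h3 : ρ D.m ^ p * (e * ρ a ^ k) = ModAway.of _ _ (hT.inclusion hN s) ^ p := by
    have := ModAway.of_eq_zero_of_dvd (α := algebraMap A T a)
      (((hT.inclusion hN).commutes π).symm ▸ map_dvd (hT.inclusion hN) hs)
    rw [map_sub, map_sub, sub_eq_zero, map_mul, map_mul, map_pow, map_pow, map_pow, map_pow,
      AlgHom.commutes, hk] at this
    rw [hρ, hρ]
    exact this
  obtain ⟨u, hu⟩ := (hD.isUnit_of.map (algebraMap (ModAway A π a) (ModAway.Over π a T))).mul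
    (h2.pow k)
  refine ⟨ModAway.of (algebraMap A T π) (algebraMap A T a) (hT.inclusion hN s) * ↑u⁻¹, ?_⟩
  change (_ * _) ^ p = e
  rw [mul_pow, ← h3, ← h1]
  have h4 : ρ D.m ^ p * (e * (ρ a' ^ p) ^ k) = e * (u : ModAway.Over π a T) ^ p := by
    rw [hu, mul_pow]
    change _ = e * (ρ D.m ^ p * (ρ a' ^ k) ^ p)
    ring
  rw [h4, mul_assoc, ← mul_pow, Units.mul_inv, one_pow, mul_one]

end Frobenius

section IndFiniteEtale

include hT in
-- The subalgebras are the images of the finite Galois N. They are directed, since the normal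
-- closure of a compositum again has a Galois family.
theorem isIndFiniteEtale (hπ : Prime π) (ha : ¬ π ∣ a) :
    IsIndFiniteEtale (ModAway.map (algebraMap A T) π a) := by
  refine IsIndFiniteEtale.of_directedOn _
    { C : Subalgebra (ModAway A π a) (ModAway.Over π a T) | ∃ (N : IntermediateField K Ω)
      (hN : N.HasGaloisFamily π a), FiniteDimensional K N ∧ IsGalois K N ∧
        C = (hT.overInclusion hN).range } ?_ ?_ ?_ ?_
  · obtain ⟨N, -, hN, h1, h2⟩ := exists_isGalois_hasGaloisFamily hπ ha
      (IntermediateField.HasGaloisFamily.bot (K := K) (Ω := Ω))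
    exact ⟨_, N, hN, h1, h2, rfl⟩
  · rintro _ ⟨N, hN, -, -, rfl⟩ _ ⟨N', hN', -, -, rfl⟩
    obtain ⟨N'', hle, hN'', h1, h2⟩ := exists_isGalois_hasGaloisFamily hπ ha (hN.sup hN')
    exact ⟨_, ⟨N'', hN'', h1, h2, rfl⟩,
      hT.range_overInclusion_mono hN hN'' (le_sup_left.trans hle),
      hT.range_overInclusion_mono hN' hN'' (le_sup_right.trans hle)⟩
  · intro e
    obtain ⟨t, k, h⟩ := ModAway.exists_of_eq_mul e
    obtain ⟨N, hN, htN⟩ := hT.algebraMap_mem t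
    obtain ⟨N, hle, hN, h1, h2⟩ := exists_isGalois_hasGaloisFamily hπ ha hN
    exact ⟨_, ⟨N, hN, h1, h2, rfl⟩, hT.overInclusion_mem_range hN h (hle htN)⟩
  · rintro _ ⟨N, hN, h1, h2, rfl⟩
    obtain ⟨ι, _, D, hD⟩ := hN.exists_galoisCoordinates
    obtain ⟨_, _⟩ := D.finite_and_etale (ModAway A π a) (ModAway.Over π a (integralClosure A N))
      hD.isUnit_of
    let e := AlgEquiv.ofInjective _ (hT.overInclusion_injective hπ.ne_zero hN)
    exact ⟨Module.Finite.equiv e.toLinearEquiv, Algebra.Etale.of_equiv e⟩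

end IndFiniteEtale

end IsIntegralClosureIn

/-! ### The tower R ⊆ A ⊆ Ω and the proof of the theorem. -/

section FractionFieldTower

variable (R S A : Type*) [CommRing R] [CommRing S] [IsDomain S] [Algebra R S]
  [Algebra.IsIntegral R S] [CommRing A] [Algebra R A]
  [Algebra A (AlgebraicClosure (FractionRing S))]
  [IsScalarTower R A (AlgebraicClosure (FractionRing S))]

include R in
lemma isAlgebraic_algebraicClosure_fractionRing [IsDomain R] [FaithfulSMul R S] :
    Algebra.IsAlgebraic A (AlgebraicClosure (FractionRing S)) := by
  have : Algebra.IsAlgebraic S (AlgebraicClosure (FractionRing S)) :=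
    (IsFractionRing.comap_isAlgebraic_iff (K := FractionRing S)).mpr inferInstance
  have halg : Algebra.IsAlgebraic R (AlgebraicClosure (FractionRing S)) :=
    Algebra.IsAlgebraic.trans R S _
  have : FaithfulSMul R (AlgebraicClosure (FractionRing S)) := by
    rw [faithfulSMul_iff_algebraMap_injective, IsScalarTower.algebraMap_eq R S]
    exact (algebraMap_algebraicClosure_injective S).comp (FaithfulSMul.algebraMap_injective R S)
  refine halg.extendScalars (R := R) (Function.Injective.of_comp
    (f := algebraMap A (AlgebraicClosure (FractionRing S))) ?_)
  rw [← RingHom.coe_comp, ← IsScalarTower.algebraMap_eq]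
  exact FaithfulSMul.algebraMap_injective R _

variable {S A} [Algebra.IsIntegral R A]

include R in
lemma isIntegral_iff_of_isIntegral (z : AlgebraicClosure (FractionRing S)) :
    IsIntegral S z ↔ IsIntegral A z := by
  constructor
  · intro h
    exact (isIntegral_trans (R := R) (A := S) z h).tower_top
  · intro h
    exact (isIntegral_trans (R := R) (A := A) z h).tower_top

end FractionFieldTower

lemma Ideal.bijective_pow_of_lift_frobenius {T : Type*} [CommRing T] (P : Ideal T) [P.IsPrime]
    {p : ℕ} [Fact p.Prime] (hp : (p : T) ∈ P) {Φ : T → T} (hΦ : Function.Surjective Φ) {e : ℕ}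
    (h : ∀ t, Ideal.Quotient.mk P (Φ t) = Ideal.Quotient.mk P t ^ p ^ (e + 1)) :
    Function.Bijective fun x : T ⧸ P ↦ x ^ p := by
  have : CharP (T ⧸ P) p := .of_prime_of_natCast_eq_zero Fact.out
    ((map_natCast (Ideal.Quotient.mk P) p).symm.trans (Ideal.Quotient.eq_zero_iff_mem.mpr hp))
  refine ⟨frobenius_inj (T ⧸ P) p, fun x ↦ ?_⟩
  obtain ⟨t, rfl⟩ := Ideal.Quotient.mk_surjective x
  obtain ⟨s, rfl⟩ := hΦ t
  refine ⟨Ideal.Quotient.mk P s ^ p ^ e, ?_⟩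
  change (_ ^ p ^ e) ^ p = _
  rw [← pow_mul, ← pow_succ, h]

/-- The elements of the absolute integral closure of `S` that lie in an intermediate field. -/
def AbsoluteIntegralClosure.subalgebra (S : Type*) {K : Type*} [CommRing S] [IsDomain S] [Field K]
    [Algebra K (AlgebraicClosure (FractionRing S))]
    (L : IntermediateField K (AlgebraicClosure (FractionRing S)))
    (hL : ∀ s : S, algebraMap S (AlgebraicClosure (FractionRing S)) s ∈ L) :
    Subalgebra S (AbsoluteIntegralClosure S) where
  carrier := { z | (z : AlgebraicClosure (FractionRing S)) ∈ L }
  mul_mem' := fun h h' ↦ L.mul_mem h h'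
  add_mem' := fun h h' ↦ L.add_mem h h'
  algebraMap_mem' := hL

/-- `n = d - 1` is the number of variables `x_2, …, x_d`. -/
theorem corollary7p2 (p : ℕ) [Fact p.Prime]
    (F : Type w) [Field F] [Finite F] [CharP F p]
    (V : Type u) [CommRing V] [IsDomain V] [IsDiscreteValuationRing V]
    [Algebra (WittVector p F) V] (hV : IsTotallyRamifiedOverWitt p F V)
    (π : V) (hπ : Irreducible π) (n : ℕ)
    (S : Type v) [CommRing S] [IsDomain S] [IsLocalRing S]
    [IsAdicComplete (IsLocalRing.maximalIdeal S) S]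
    [Algebra (MvPowerSeries (Fin n) V) S] [Module.Finite (MvPowerSeries (Fin n) V) S]
    (hRS : Function.Injective (algebraMap (MvPowerSeries (Fin n) V) S))
    (a : MvPowerSeries (Fin n) V)
    (hétale : (Localization.awayMap (algebraMap (MvPowerSeries (Fin n) V) S) a).Etale)
    (hht : (Ideal.span {MvPowerSeries.C π, a}).height = 2) :
    (∃ i : RInfty p n V →+* AbsoluteIntegralClosure S, IsEmbeddingOver p n i) ∧
    ∀ i : RInfty p n V →+* AbsoluteIntegralClosure S, IsEmbeddingOver p n i →
    ∀ ϖ α : RInfty p n V,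
      ϖ = RInfty.ofBase p n V (MvPowerSeries.C π) → α = RInfty.ofBase p n V a →
    ∃ (T : Subalgebra S (AbsoluteIntegralClosure S)) (j : RInfty p n V →+* T),
      (∀ r, (j r : AbsoluteIntegralClosure S) = i r) ∧
      -- `T` is normal, and `π` is a non-zero non-unit of `T`
      IsIntegrallyClosed T ∧ j ϖ ≠ 0 ∧ ¬ IsUnit (j ϖ) ∧
      -- `T/πT` is a reduced `𝔽_p`-algebra
      CharP (T ⧸ Ideal.span {j ϖ}) p ∧ IsReduced (T ⧸ Ideal.span {j ϖ}) ∧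
      -- Frobenius is bijective on `T/P` for the minimal primes `P` over `πT`
      (∀ P ∈ (Ideal.span {j ϖ}).minimalPrimes,
        Function.Bijective (fun x : T ⧸ P => x ^ p)) ∧
      -- `R_∞/πR_∞[1/a] → T/πT[1/a]` is ind-(finite étale), with a perfect target
      IsIndFiniteEtale (ModAway.map j ϖ α) ∧
      Function.Bijective (fun x : ModAway T (j ϖ) (j α) => x ^ p) ∧
      -- each minimal prime `P` over `πT` has a lift of the `q`-th power map of `T/P` to `T`
      (∀ P ∈ (Ideal.span {j ϖ}).minimalPrimes, ∃ Φ : T ≃+* T,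
        Ideal.map Φ P = P ∧
        ∀ t : T, Ideal.Quotient.mk P (Φ t) = Ideal.Quotient.mk P t ^ Nat.card F) := by
  refine ⟨RInfty.exists_isEmbeddingOver hRS, ?_⟩
  rintro i ⟨hi, hiR⟩ ϖ α hϖ hα
  have hp : p.Prime := Fact.out
  -- the residue field
  have hπp : π ∣ (p : V) := hV.dvd_natCast hπ
  obtain ⟨e, he⟩ : ∃ e : ℕ, Nat.card F = p ^ (e + 1) := by
    have := Fintype.ofFinite F
    obtain ⟨⟨k, hk⟩, -, h⟩ := FiniteField.card F p
    obtain ⟨e, rfl⟩ := Nat.exists_eq_succ_of_ne_zero hk.ne'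
    exact ⟨e, by rw [Nat.card_eq_fintype_card]; exact h⟩
  have hq : ∀ x : V, π ∣ x ^ p ^ (e + 1) - x := he ▸ hV.dvd_pow_natCard_sub hπ
  -- Characteristic zero makes the algebraic closure Ω of K separable, hence Galois over K.
  have : CharZero V := hV.charZero
  -- the base `R_∞`
  let R := MvPowerSeries (Fin n) V
  let A := RInfty p n V
  let Ω := AlgebraicClosure (FractionRing S)
  have : IsDomain R := NoZeroDivisors.to_isDomain _
  have hϖprime : Prime ϖ := hϖ ▸ RInfty.prime_ofBase_C hπ.prime
  have hϖα : ¬ ϖ ∣ α := by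
    rw [hϖ, hα]
    exact RInfty.not_ofBase_C_dvd hπ.prime hht
  have hϖp : ϖ ∣ (p : A) := by
    have := map_dvd ((RInfty.ofBase p n V).comp MvPowerSeries.C) hπp
    rwa [map_natCast, RingHom.comp_apply, ← hϖ] at this
  have hfrob : ∀ r : A, ∃ s, ϖ ∣ s ^ p - r := hϖ ▸ RInfty.dvd_pow_sub hπ.prime hπp hq
  let φ : A ≃+* A := .ofBijective _ (RInfty.powVars_bijective (n := n) (V := V) (p := p) (e + 1))
  have hφϖ : φ ϖ = ϖ := by
    rw [hϖ]
    exact RInfty.powVars_ofBase_C _ π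
  have hφ : ∀ r, ϖ ∣ φ r - r ^ p ^ (e + 1) := by
    rw [hϖ]
    exact RInfty.dvd_powVars_sub_pow hπ.prime hπp hq
  -- the tower of fields
  let : Algebra R A := (RInfty.ofBase p n V).toAlgebra
  let : Algebra A Ω := ((algebraMap (AbsoluteIntegralClosure S) Ω).comp i).toAlgebra
  have : IsScalarTower R A Ω := .of_algebraMap_eq fun r ↦
    (IsScalarTower.algebraMap_apply R S Ω r).trans
      (congrArg (algebraMap (AbsoluteIntegralClosure S) Ω) (RingHom.congr_fun hiR r).symm)
  have : FaithfulSMul R S := (faithfulSMul_iff_algebraMap_injective _ _).mpr hRS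
  have : FaithfulSMul A Ω := (faithfulSMul_iff_algebraMap_injective _ _).mpr
    (Subtype.val_injective.comp hi)
  have : Algebra.IsIntegral R A := ⟨RInfty.ofBase_isIntegralElem⟩
  let K := FractionRing A
  let : Algebra K Ω := FractionRing.liftAlgebra A Ω
  have : IsScalarTower A K Ω := inferInstance
  have : Algebra.IsAlgebraic A Ω := isAlgebraic_algebraicClosure_fractionRing R S A
  have : Algebra.IsAlgebraic K Ω := (IsFractionRing.comap_isAlgebraic_iff (A := A)).mp inferInstance
  have : CharZero A := charZero_of_injective_ringHom (f := (RInfty.ofBase p n V).comp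
    MvPowerSeries.C) ((RInfty.of_injective p 0).comp (MvPowerSeries.C_injective))
  have : CharZero K := charZero_of_injective_algebraMap (FaithfulSMul.algebraMap_injective A K)
  have : IsAlgClosure A Ω := ⟨inferInstance, inferInstance⟩
  have : IsAlgClosure K Ω := ⟨inferInstance, inferInstance⟩
  have : Normal K Ω := IsAlgClosure.normal K Ω
  have : IsGalois K Ω := ⟨⟩
  -- Any extension of φ to Ω will do: the choice is corrected by a Galois element for each prime P
  -- separately.
  let Φ₁ : Ω ≃+* Ω := IsAlgClosure.equivOfEquiv Ω Ω φ
  have hΦ₁ : ∀ r, Φ₁ (algebraMap A Ω r) = algebraMap A Ω (φ r) :=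
    IsAlgClosure.equivOfEquiv_algebraMap Ω Ω φ
  -- the ring `T`
  let L : IntermediateField K Ω := galoisFamilyUnion K Ω ϖ α
  have hSL : ∀ s : S, algebraMap S Ω s ∈ L := by
    have haΩ : algebraMap R Ω a ≠ 0 := by
      rw [IsScalarTower.algebraMap_apply R A Ω]
      refine (map_ne_zero_iff _ (FaithfulSMul.algebraMap_injective A Ω)).mpr fun h ↦ hϖα ?_
      rw [hα]
      exact h ▸ dvd_zero _
    have := algebraMap_mem_galoisFamilyUnion (A := A) (K := K) haΩ hétale ϖ
    rw [show algebraMap R A a = α from hα.symm] at this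
    exact this
  let T := AbsoluteIntegralClosure.subalgebra S L hSL
  let j : A →+* T := i.codRestrict T fun r ↦ by
    have := L.algebraMap_mem (algebraMap A K r)
    rw [← IsScalarTower.algebraMap_apply] at this
    exact this
  let : Algebra A T := j.toAlgebra
  have : IsScalarTower A T Ω := .of_algebraMap_eq fun _ ↦ rfl
  have : FaithfulSMul T Ω := (faithfulSMul_iff_algebraMap_injective _ _).mpr
    (Subtype.val_injective.comp Subtype.val_injective)
  -- T is cut out of S⁺ by L. Since S and A are both integral over R, integrality over S and over A
  -- is the same condition.
  have hT : IsIntegralClosureIn A T (galoisFamilyUnion K Ω ϖ α) := by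
    intro z
    rw [← isIntegral_iff_of_isIntegral R]
    constructor
    · rintro ⟨t, rfl⟩
      exact ⟨t.1.2, t.2⟩
    · rintro ⟨hz, hzL⟩
      exact ⟨⟨⟨z, hz⟩, hzL⟩, rfl⟩
  have hP : ∀ P ∈ (Ideal.span {j ϖ}).minimalPrimes, P.IsPrime ∧ j ϖ ∈ P ∧ (p : T) ∈ P := by
    intro P hPmin
    have h1 : j ϖ ∈ P := hPmin.1.2 (Ideal.mem_span_singleton_self _)
    refine ⟨hPmin.1.1, h1, Ideal.mem_of_dvd _ ?_ h1⟩
    rw [← map_natCast j]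
    exact map_dvd j hϖp
  have hlift : ∀ P ∈ (Ideal.span {j ϖ}).minimalPrimes, ∃ Φ : T ≃+* T, Ideal.map Φ P = P ∧
      ∀ t : T, Ideal.Quotient.mk P (Φ t) = Ideal.Quotient.mk P t ^ Nat.card F := by
    intro P hPmin
    obtain ⟨_, h1, h2⟩ := hP P hPmin
    rw [he]
    exact hT.exists_lift_frobenius hΦ₁ hφϖ hφ P h1 h2
  refine ⟨T, j, fun r ↦ rfl, hT.isIntegrallyClosed, ?_, ?_, hT.charP_quotient hϖprime hϖp,
    hT.isReduced_quotient hϖprime hϖα hϖp, ?_, hT.isIndFiniteEtale hϖprime hϖα,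
    hT.bijective_pow_modAway hϖprime hϖα hϖp hfrob, hlift⟩
  · refine (map_ne_zero_iff _ ?_).mpr hϖprime.ne_zero
    exact (RingHom.injective_codRestrict (f := i)).mpr hi
  · exact fun h ↦ hϖprime.not_isUnit (isUnit_of_dvd_one
      (hT.dvd_of_algebraMap_dvd hϖprime.ne_zero h.dvd))
  · intro P hPmin
    obtain ⟨_, h1, h2⟩ := hP P hPmin
    obtain ⟨Φ, -, hΦ⟩ := hlift P hPmin
    exact P.bijective_pow_of_lift_frobenius h2 Φ.surjective fun t ↦ (hΦ t).trans (by rw [he])
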